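/- **Setting.** Let $d\ge 1$, $q>2$, $M\ge 1$, $0<\delta<1$ and $g_1,g_2\in\mathbb R$ with $|g_1|,|g_2|\le 1$, and let $\Lambda\subset\mathbb Z^d$ be finite. For finite $A\subset\mathbb Z^d$ let $\mathcal H_A=\ell^2(\mathbb N^A)$ with basis vectors $\eta\in\mathbb N^A$, let $P_\eta$ be the orthogonal projection onto $\mathbb C\eta$, and let $a_x,a_x^*$ and $N_x=a_x^*a_x$ be the bosonic annihilation, creation and number operators at $x$. An *interaction potential* $\mathscr A$ assigns to each finite $A\subset\mathbb Z^d$ a bounded operator $\mathscr A(A)$ on $\mathcal H_A$, with $\mathscr A(A)=0$ if $A$ is not a (nonempty) connected subset of the lattice. Write $(\mathcal P_{\le M}\mathscr A)(A)=\chi_A\mathscr A(A)\chi_A$ with $\chi_A=\bigotimes_{x\in A}\chi(N_x\le M)$, and similarly $\mathcal P_{\le M}(O)=\chi_AO\chi_A$ for an operator $O$ on $\mathcal H_A$ that is defined on the span of the basis vectors. For $\kappa>1$ put $$|||\mathscr A|||_\kappa=\sup_{x}\sum_{A\ni x}\kappa^{|A|}\,\|\mathscr A(A)\|_\kappa,\qquad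 \|O\|_\kappa=\sup_{w\in\mathbb R_+^A,\ \kappa^{-1}\le w\le\kappa}\|w^N\breve O w^{-N}\|,$$ where $w^N=\prod_{x\in A} w(x)^{N_x}$ and $\breve O$ has the matrix elements $|\langle\eta,O\eta'\rangle|$. Let $$\mathrm{ad}_{\mathscr A}(\mathscr B)(A)=[\mathscr A,\mathscr B](A)=\sum_{A_1\cup A_2=A}[\mathscr A(A_1),\mathscr B(A_2)],\qquad e^{\mathrm{ad}_{\mathscr A}}(\mathscr B)=\sum_{n\ge0}\tfrac1{n!}\mathrm{ad}^n_{\mathscr A}(\mathscr B),$$ operators on $\mathcal H_{A_i}$ being identified with operators on $\mathcal H_A$ by tensoring with the identity. The free potential is $\mathscr E_0(\{x\})=\mathcal P_{\le M}(N_x^q)$ for $x\in\Lambda$ and $\mathscr E_0(A)=0$ for all other $A$. The potential of the full Hamiltonian is $\mathscr E=\mathscr E_0+\mathscr V$, where $$\mathscr V(A)=\sum_{x\in\Lambda:\ \{x'\in\Lambda:|x'-x|\le1\}=A}\mathcal P_{\le M}\Big(g_1(a_x+a_x^*)^2+\tfrac12\sum_{x'\in\Lambda,\,x'\sim x}g_2\,(a_x^*a_{x'}+a_xa_{x'}^*)\Big),$$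 the operator in brackets being regarded as an operator on $\mathcal H_A$. With $E_A(\eta)=\sum_{x\in A}\eta_x^q$, the resonant part $(\mathcal P_{\rm Res}\mathscr A)(A)$ (respectively the nonresonant part $(\mathcal P_{\rm NRes}\mathscr A)(A)$) is the sum of $P_\eta\mathscr A(A)P_{\eta'}$ over those $\eta,\eta'\in\mathbb N^A$ with all entries $\le M$ for which $|E_A(\eta)-E_A(\eta')|\le\delta^{-1}M$ (respectively $>\delta^{-1}M$). **Proposition (perturbative diagonalization).** Let $\nu=\frac1{4(2d+3)}$ and $e(r)=(2r-1)/3$. For every $r=0,1,2,\dots$ there are constants $C(r)$ and $\delta_0(r)>0$, with $\delta_0$ nonincreasing in $r$, depending only on $d,q,r$, such that for all $M,g_1,g_2,\Lambda,\delta$ as above there are potentials $\mathscr F^{(r)},\mathscr G^{(r)}$ ($r\ge0$) and $\mathscr K^{(r)}$ ($r\ge1$) with the following properties for every $r\ge 0$ with $\delta<\delta_0(r)$. The families $\mathscr F^{(r)},\mathscr G^{(r)},\mathscr K^{(r+1)}$ are interaction potentials, and $$e^{\mathrm{ad}_{\mathscr K^{(r)}}}\cdots e^{\mathrm{ad}_{\mathscr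 K^{(2)}}}e^{\mathrm{ad}_{\mathscr K^{(1)}}}(\mathscr E)=\mathscr E_0+\mathscr F^{(r)}+\mathscr G^{(r)}$$ (the left-hand side is $\mathscr E$ for $r=0$), where each of the successive exponential series converges in $|||\cdot|||_{\delta^{-\nu}}$. Moreover: 1. $\mathcal P_{\le M}(\mathscr F^{(r)})=\mathscr F^{(r)}$, $\mathcal P_{\le M}(\mathscr G^{(r)})=\mathscr G^{(r)}$, $\mathcal P_{\le M}(\mathscr K^{(r+1)})=\mathscr K^{(r+1)}$; 2. $|||\mathscr F^{(r)}|||_{\delta^{-\nu}}\le C(r)\,M\,\delta^{e(r)}$ and $\mathcal P_{\rm NRes}(\mathscr F^{(r)})=\mathscr F^{(r)}$; 3. $|||\mathscr G^{(r)}|||_{\delta^{-\nu}}\le C(r)\,\delta^{e(0)}M$ and $\mathcal P_{\rm Res}(\mathscr G^{(r)})=\mathscr G^{(r)}$; 4. $|||\mathscr K^{(r+1)}|||_{\delta^{-\nu}}\le C(r)\,\delta^{e(r)+1}$. -/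

import Mathlib

open scoped ENNReal

namespace MBL

noncomputable section

/-! ### The lattice -/

/-- Sites of the lattice `ℤ^d`. -/
abbrev Site (d : ℕ) := Fin d → ℤ

/-- Nearest-neighbour graph on `ℤ^d`: `x ∼ x'` iff `∑ i, |x i - x' i| = 1`, equivalently iff the
Euclidean distance of `x` and `x'` is `1`. -/
def lattice (d : ℕ) : SimpleGraph (Site d) where
  Adj x y := ∑ i, |x i - y i| = 1
  symm := ⟨fun x y h => by simpa only [abs_sub_comm] using h⟩
  loopless := ⟨fun x h => by simp at h⟩

variable {d : ℕ}

/-- A finite set of sites is connected if it induces a connected (in particular nonempty)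
subgraph of the lattice. -/
def IsConn (A : Finset (Site d)) : Prop :=
  ((lattice d).induce (A : Set (Site d))).Connected

/-- The star `{x' ∈ Λ : |x' - x| ≤ 1}`. -/
def siteStar (Λ : Finset (Site d)) (x : Site d) : Finset (Site d) :=
  open Classical in Λ.filter fun y => y = x ∨ (lattice d).Adj x y

/-! ### Hilbert spaces, basis vectors, tensoring with the identity -/

/-- The phase space `Ω_A = ℕ^A`. -/
abbrev Conf (A : Finset (Site d)) := A → ℕ

/-- The Hilbert space `H_A = ℓ²(ℕ^A)`. -/
abbrev Hil (A : Finset (Site d)) := lp (fun _ : Conf A => ℂ) 2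

/-- Bounded operators on `H_A`. -/
abbrev Op (A : Finset (Site d)) := Hil A →L[ℂ] Hil A

/-- The basis vector `δ_η`. -/
def ket {A : Finset (Site d)} (η : Conf A) : Hil A := lp.single 2 η (1 : ℂ)

/-- The matrix element `⟨η, O η'⟩`. -/
def mel {A : Finset (Site d)} (O : Op A) (η η' : Conf A) : ℂ := inner ℂ (ket η) (O (ket η'))

/-- The operator `|η⟩⟨η'|`, that is `ψ ↦ ⟨η', ψ⟩ η`. -/
def ketbra {A : Finset (Site d)} (η η' : Conf A) : Op A :=
  (innerSL ℂ (ket η')).smulRight (ket η)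

/-- The one-dimensional orthogonal projection `P_η`. -/
def proj {A : Finset (Site d)} (η : Conf A) : Op A := ketbra η η

section Tensor

variable {Ω X Y : Type*}

theorem tsum_enorm_sq (g : lp (fun _ : Ω => ℂ) 2) : ∑' i, ‖g i‖ₑ ^ 2 = ‖g‖ₑ ^ 2 := by
  have h := lp.hasSum_norm (p := 2) (by norm_num) g
  have h2 : HasSum (fun i => ‖g i‖ ^ 2) (‖g‖ ^ 2) := by
    simpa using h
  have h3 := ENNReal.ofReal_tsum_of_nonneg (fun i => by positivity) h2.summable
  rw [h2.tsum_eq] at h3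
  rw [← ofReal_norm, ← ENNReal.ofReal_pow (norm_nonneg _), h3]
  refine tsum_congr fun i => ?_
  rw [← ofReal_norm, ← ENNReal.ofReal_pow (norm_nonneg _)]

theorem memlp_two_of_tsum {g : Ω → ℂ} (hg : ∑' i, ‖g i‖ₑ ^ 2 ≠ ⊤) :
    Memℓp (E := fun _ : Ω => ℂ) g 2 := by
  apply memℓp_gen
  have h := ENNReal.summable_toReal hg
  simpa using h

/-- The partial function `x ↦ f (x, y)` of a square-summable function of two variables. -/
def slice (e : Ω ≃ X × Y) (y : Y) (f : lp (fun _ : Ω => ℂ) 2) : lp (fun _ : X => ℂ) 2 :=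
  ⟨fun x => f (e.symm (x, y)), memlp_two_of_tsum (by
    have hinj : Function.Injective fun x : X => e.symm (x, y) := fun a b h => by
      simpa using h
    refine ne_top_of_le_ne_top ?_ (ENNReal.tsum_comp_le_tsum_of_injective hinj
      (fun ω => ‖f ω‖ₑ ^ 2))
    rw [tsum_enorm_sq]
    exact ENNReal.pow_ne_top (by simp))⟩

theorem tsum_slice (e : Ω ≃ X × Y) (O : lp (fun _ : X => ℂ) 2 →L[ℂ] lp (fun _ : X => ℂ) 2)
    (f : lp (fun _ : Ω => ℂ) 2) :
    ∑' ω, ‖O (slice e (e ω).2 f) (e ω).1‖ₑ ^ 2 ≤ (‖O‖ₑ * ‖f‖ₑ) ^ 2 := by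
  calc ∑' ω, ‖O (slice e (e ω).2 f) (e ω).1‖ₑ ^ 2
      = ∑' p : X × Y, ‖O (slice e p.2 f) p.1‖ₑ ^ 2 :=
        e.tsum_eq (fun p : X × Y => ‖O (slice e p.2 f) p.1‖ₑ ^ 2)
    _ = ∑' y, ∑' x, ‖O (slice e y f) x‖ₑ ^ 2 := by
        rw [ENNReal.tsum_prod', ENNReal.tsum_comm]
    _ = ∑' y, ‖O (slice e y f)‖ₑ ^ 2 := by
        refine tsum_congr fun y => tsum_enorm_sq _
    _ ≤ ∑' y, ‖O‖ₑ ^ 2 * ‖slice e y f‖ₑ ^ 2 := by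
        refine ENNReal.tsum_le_tsum fun y => ?_
        rw [← mul_pow]
        gcongr
        exact O.le_opENorm _
    _ = ‖O‖ₑ ^ 2 * ∑' y, ∑' x, ‖f (e.symm (x, y))‖ₑ ^ 2 := by
        rw [ENNReal.tsum_mul_left]
        congr 1
        refine tsum_congr fun y => (tsum_enorm_sq _).symm
    _ = ‖O‖ₑ ^ 2 * ∑' p : X × Y, ‖f (e.symm p)‖ₑ ^ 2 := by
        rw [ENNReal.tsum_prod', ENNReal.tsum_comm]
    _ = ‖O‖ₑ ^ 2 * ‖f‖ₑ ^ 2 := by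
        rw [e.symm.tsum_eq (fun ω => ‖f ω‖ₑ ^ 2), tsum_enorm_sq]
    _ = (‖O‖ₑ * ‖f‖ₑ) ^ 2 := (mul_pow _ _ _).symm

/-- The vector `(O ⊗ 1) f`, for `Ω ≃ X × Y` and `ℓ²(Ω) = ℓ²(X) ⊗ ℓ²(Y)`. -/
def tensorIdFun (e : Ω ≃ X × Y) (O : lp (fun _ : X => ℂ) 2 →L[ℂ] lp (fun _ : X => ℂ) 2)
    (f : lp (fun _ : Ω => ℂ) 2) : lp (fun _ : Ω => ℂ) 2 :=
  ⟨fun ω => O (slice e (e ω).2 f) (e ω).1, memlp_two_of_tsum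
    (ne_top_of_le_ne_top (ENNReal.pow_ne_top (by finiteness)) (tsum_slice e O f))⟩

theorem norm_tensorIdFun_le (e : Ω ≃ X × Y)
    (O : lp (fun _ : X => ℂ) 2 →L[ℂ] lp (fun _ : X => ℂ) 2) (f : lp (fun _ : Ω => ℂ) 2) :
    ‖tensorIdFun e O f‖ ≤ ‖O‖ * ‖f‖ := by
  have h : ‖tensorIdFun e O f‖ₑ ^ 2 ≤ (‖O‖ₑ * ‖f‖ₑ) ^ 2 := by
    rw [← tsum_enorm_sq]
    exact tsum_slice e O f
  have h2 : ‖tensorIdFun e O f‖ₑ ≤ ‖O‖ₑ * ‖f‖ₑ :=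
    (ENNReal.pow_le_pow_left_iff two_ne_zero).1 h
  rw [← ofReal_norm, ← ofReal_norm, ← ofReal_norm, ← ENNReal.ofReal_mul (norm_nonneg _)] at h2
  exact (ENNReal.ofReal_le_ofReal_iff (by positivity)).1 h2

/-- For `Ω ≃ X × Y`, the operator `O ⊗ 1` on `ℓ²(Ω) = ℓ²(X) ⊗ ℓ²(Y)`. -/
def tensorId (e : Ω ≃ X × Y) (O : lp (fun _ : X => ℂ) 2 →L[ℂ] lp (fun _ : X => ℂ) 2) :
    lp (fun _ : Ω => ℂ) 2 →L[ℂ] lp (fun _ : Ω => ℂ) 2 :=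
  LinearMap.mkContinuous
    { toFun := tensorIdFun e O
      map_add' := fun f g => by
        ext ω
        have h : slice e (e ω).2 (f + g) = slice e (e ω).2 f + slice e (e ω).2 g := rfl
        change O (slice e (e ω).2 (f + g)) (e ω).1 =
          O (slice e (e ω).2 f) (e ω).1 + O (slice e (e ω).2 g) (e ω).1
        rw [h, map_add]
        rfl
      map_smul' := fun c f => by
        ext ω
        have h : slice e (e ω).2 (c • f) = c • slice e (e ω).2 f := rfl
        change O (slice e (e ω).2 (c • f)) (e ω).1 = c • O (slice e (e ω).2 f) (e ω).1
        rw [h, map_smul]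
        rfl }
    ‖O‖ (norm_tensorIdFun_le e O)

end Tensor

/-- The splitting `ℕ^A ≃ ℕ^B × ℕ^(A \ B)` for `B ⊆ A`. -/
def splitConf {B A : Finset (Site d)} (h : B ⊆ A) :
    Conf A ≃ Conf B × ({x : A // x.1 ∉ B} → ℕ) where
  toFun η := (fun x => η ⟨x.1, h x.2⟩, fun x => η x.1)
  invFun p := fun x => open Classical in if hx : x.1 ∈ B then p.1 ⟨x.1, hx⟩ else p.2 ⟨x, hx⟩
  left_inv η := by
    funext x
    by_cases hx : x.1 ∈ B <;> simp [hx]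
  right_inv p := by
    refine Prod.ext ?_ ?_
    · funext x
      simp
    · funext x
      simp [x.2]

/-- The operator `O ⊗ 1_{A \ B}` on `H_A`, for an operator `O` on `H_B` with `B ⊆ A`. -/
def extend {B A : Finset (Site d)} (h : B ⊆ A) (O : Op B) : Op A := tensorId (splitConf h) O

/-! ### The occupation-number cutoff -/

/-- The cut-off phase space `{0, 1, …, ⌊M⌋}^A`. -/
def cutConf (M : ℝ) (A : Finset (Site d)) : Finset (Conf A) :=
  Fintype.piFinset fun _ => Finset.range (⌊M⌋₊ + 1)

/-- The projection `⊗_{x ∈ A} χ(N_x ≤ M)`. -/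
def cutProj (M : ℝ) (A : Finset (Site d)) : Op A := ∑ η ∈ cutConf M A, proj η

/-- The cutoff `O ↦ (⊗_{x ∈ A} χ(N_x ≤ M)) O (⊗_{x ∈ A} χ(N_x ≤ M))` of bounded operators. -/
def cutOp (M : ℝ) {A : Finset (Site d)} (O : Op A) : Op A := cutProj M A * O * cutProj M A

/-- (Possibly unbounded) operators defined on the span of the basis vectors `δ_η`, that is, on
finitely supported functions on `ℕ^A`, and leaving it invariant. -/
abbrev CoreOp (A : Finset (Site d)) := Module.End ℂ (Conf A →₀ ℂ)

/-- The cutoff `(⊗_{x ∈ A} χ(N_x ≤ M)) T (⊗_{x ∈ A} χ(N_x ≤ M))` of an operator `T` defined on the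
span of the basis vectors. It has finite rank, hence is a bounded operator on `H_A`. -/
def cutCore (M : ℝ) {A : Finset (Site d)} (T : CoreOp A) : Op A :=
  ∑ η ∈ cutConf M A, ∑ η' ∈ cutConf M A, (T (Finsupp.single η' 1) η) • ketbra η η'

/-! ### The Hamiltonian -/

/-- The annihilation operator `a_x`: `a_x δ_η = √(η x) δ_{η - 1_x}`, so that
`(a_x f)(η) = √(η x + 1) f(η + 1_x)`. -/
def ann {A : Finset (Site d)} (x : A) : CoreOp A :=
  Finsupp.linearCombination ℂ fun η : Conf A =>
    Finsupp.single (Function.update η x (η x - 1)) ((Real.sqrt (η x) : ℝ) : ℂ)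

/-- The creation operator `a_x^*`: `a_x^* δ_η = √(η x + 1) δ_{η + 1_x}`. -/
def cre {A : Finset (Site d)} (x : A) : CoreOp A :=
  Finsupp.linearCombination ℂ fun η : Conf A =>
    Finsupp.single (Function.update η x (η x + 1)) ((Real.sqrt (η x + 1) : ℝ) : ℂ)

/-- The operator `N_x^q`, where `N_x = a_x^* a_x` is diagonal: `N_x δ_η = η x δ_η`. -/
def numPow (q : ℝ) {A : Finset (Site d)} (x : A) : CoreOp A :=
  Finsupp.linearCombination ℂ fun η : Conf A =>
    Finsupp.single η ((((η x : ℕ) : ℝ) ^ q : ℝ) : ℂ)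

/-- The interaction part `H_x - N_x^q` of the local energy,
`g₁ (a_x + a_x^*)² + ½ ∑_{x' ∼ x} g₂ (a_x^* a_{x'} + a_x a_{x'}^*)`, with `x'` ranging over the
neighbours of `x` in `A`. -/
def siteInteraction (g₁ g₂ : ℝ) {A : Finset (Site d)} (x : A) : CoreOp A :=
  (g₁ : ℂ) • (ann x + cre x) ^ 2 +
    (1 / 2 : ℂ) • ∑ x' : A, open Classical in
      if (lattice d).Adj x.1 x'.1 then (g₂ : ℂ) • (cre x * ann x' + ann x * cre x') else 0

/-! ### Interaction potentials -/

/-- A family of bounded operators on `H_A`, one for each finite `A ⊆ ℤ^d`. -/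
abbrev Potential (d : ℕ) := ∀ A : Finset (Site d), Op A

/-- Interaction potentials: families that vanish on sets that are not connected. -/
def IsInteraction (𝒜 : Potential d) : Prop := ∀ A, ¬ IsConn A → 𝒜 A = 0

/-- The potential of the free Hamiltonian in the volume `Λ`: it equals the cutoff of `N_x^q` at
`A = {x}`, `x ∈ Λ`, and vanishes at all other sets. -/
def freePotential (q M : ℝ) (Λ : Finset (Site d)) : Potential d := fun A =>
  open Classical in
  if A.card = 1 ∧ A ⊆ Λ then cutCore M (∑ x : A, numPow q x) else 0

/-- The potential of the full Hamiltonian in the volume `Λ`. Its on-site terms `N_x^q` sit at the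
singletons `{x}`, and the remainder `H_x - N_x^q` of the local energy of each `x ∈ Λ` sits at the
star `{x' ∈ Λ : |x' - x| ≤ 1}`. -/
def fullPotential (q M g₁ g₂ : ℝ) (Λ : Finset (Site d)) : Potential d := fun A =>
  freePotential q M Λ A + ∑ x : A, open Classical in
    if siteStar Λ x.1 = A then cutCore M (siteInteraction g₁ g₂ x) else 0

/-- The cutoff of a potential. -/
def cutPotential (M : ℝ) (𝒜 : Potential d) : Potential d := fun A => cutOp M (𝒜 A)

/-! ### Norms -/

/-- The operator norm on `ℓ²(Ω)` of a matrix `k` with nonnegative entries (`∞` if unbounded), that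
is the supremum of `‖k f‖` over nonnegative `f` with `‖f‖ ≤ 1`; for matrices with nonnegative
entries, restricting to nonnegative vectors does not change the operator norm. -/
def kernelNorm {Ω : Type*} (k : Ω → Ω → ℝ≥0∞) : ℝ≥0∞ :=
  ⨆ f : Ω → ℝ≥0∞, ⨆ _ : ∑' η, f η ^ 2 ≤ 1,
    (∑' η, (∑' η', k η η' * f η') ^ 2) ^ (1 / 2 : ℝ)

/-- For `κ > 1`, the weighted operator norm `sup_w ‖w^N Ŏ w^(-N)‖`, where `Ŏ` has the matrix
elements `|⟨η, O η'⟩|`, `w^N = ∏ x, w(x)^(N_x)`, and `w` ranges over the positive functions on `A`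
with `κ⁻¹ ≤ w ≤ κ`. -/
def opNormW (κ : ℝ) {A : Finset (Site d)} (O : Op A) : ℝ≥0∞ :=
  ⨆ w : A → ℝ, ⨆ _ : ∀ x, κ⁻¹ ≤ w x ∧ w x ≤ κ,
    kernelNorm fun η η' : Conf A =>
      ENNReal.ofReal ((∏ x, w x ^ η x) * ‖mel O η η'‖ * (∏ x, w x ^ η' x)⁻¹)

/-- For `κ > 1`, the norm `|||𝒜|||_κ = sup_x ∑_{A ∋ x} κ^|A| ‖𝒜(A)‖_κ` of potentials. -/
def potNorm (κ : ℝ) (𝒜 : Potential d) : ℝ≥0∞ :=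
  ⨆ x : Site d, ∑' A : {A : Finset (Site d) // x ∈ A},
    ENNReal.ofReal κ ^ A.1.card * opNormW κ (𝒜 A.1)

/-! ### Commutators and exponentials of potentials -/

/-- `ad_𝒜(ℬ)(A) = [𝒜, ℬ](A) = ∑_{A₁ ∪ A₂ = A} [𝒜(A₁), ℬ(A₂)]`. -/
def ad (𝒜 ℬ : Potential d) : Potential d := fun A =>
  ∑ A₁ : A.powerset, ∑ A₂ : A.powerset, open Classical in
    if A₁.1 ∪ A₂.1 = A then
      ⁅extend (Finset.mem_powerset.1 A₁.2) (𝒜 A₁.1), extend (Finset.mem_powerset.1 A₂.2) (ℬ A₂.1)⁆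
    else 0

/-- The `n`-th term `(1/n!) ad_𝒜^n(ℬ)` of the exponential series. -/
def expTerm (𝒜 ℬ : Potential d) (n : ℕ) : Potential d :=
  ((n.factorial : ℂ)⁻¹) • (ad 𝒜)^[n] ℬ

/-- `e^{ad_𝒜}(ℬ) = ∑_n (1/n!) ad_𝒜^n(ℬ)`, each `A` separately. -/
def expAd (𝒜 ℬ : Potential d) : Potential d := fun A => ∑' n, expTerm 𝒜 ℬ n A

/-- The series defining `e^{ad_𝒜}(ℬ)` converges in the norm `|||·|||_κ`. -/
def ExpAdConverges (κ : ℝ) (𝒜 ℬ : Potential d) : Prop :=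
  Filter.Tendsto
    (fun n => potNorm κ ((∑ j ∈ Finset.range n, expTerm 𝒜 ℬ j) - expAd 𝒜 ℬ)) Filter.atTop (nhds 0)

/-- `e^{ad_{𝒦 r}} ⋯ e^{ad_{𝒦 1}}(ℰ)`; this is `ℰ` for `r = 0`. -/
def iterExpAd (𝒦 : ℕ → Potential d) (ℰ : Potential d) : ℕ → Potential d
  | 0 => ℰ
  | r + 1 => expAd (𝒦 (r + 1)) (iterExpAd 𝒦 ℰ r)

/-! ### Resonances -/

/-- `E_A(η) = ∑_{x ∈ A} η_x^q`. -/
def energy (q : ℝ) {A : Finset (Site d)} (η : Conf A) : ℝ := ∑ x, (η x : ℝ) ^ q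

/-- The resonant part of a potential. -/
def resPart (q M δ : ℝ) (𝒜 : Potential d) : Potential d := fun A =>
  ∑ p ∈ cutConf M A ×ˢ cutConf M A, open Classical in
    if |energy q p.1 - energy q p.2| ≤ δ⁻¹ * M then proj p.1 * 𝒜 A * proj p.2 else 0

/-- The nonresonant part of a potential. -/
def nresPart (q M δ : ℝ) (𝒜 : Potential d) : Potential d := fun A =>
  ∑ p ∈ cutConf M A ×ˢ cutConf M A, open Classical in
    if δ⁻¹ * M < |energy q p.1 - energy q p.2| then proj p.1 * 𝒜 A * proj p.2 else 0

end

end MBL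

/-!
The diagonalization is an iteration. Given `ℰ₀ + ℱ + 𝒢` with `ℱ` nonresonant and `𝒢` resonant, the
potential `𝒦` with matrix elements `⟨η, ℱ(A) η'⟩ / (E_A(η) - E_A(η'))` (`homSol`) solves the
homological equation `ad_𝒦(ℰ₀) = -ℱ` (`ad_homSol_freePotential`): the free potential is diagonal,
its on-site terms outside of `A` commute with `𝒦(A)`, and the divisors exceed `δ⁻¹ M`, so that `𝒦`
is smaller than `ℱ` by the factor `δ / M` (`potW_homSol_le`). In `e^{ad_𝒦}(ℰ₀ + ℱ + 𝒢)` the first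
order term in `ℰ₀` then cancels `ℱ`, and everything that remains besides `ℰ₀ + 𝒢` contains at least
one commutator of `𝒦` with `ℱ` or `𝒢` (`expAd_step`). Its size is at most of order
`δ^(e(r)+1) · δ^(-1/3) M = δ^(e(r+1)) M`; its nonresonant part is the new `ℱ`, its resonant part is
added to `𝒢` (`StepInvariant.succ`).

Norms of commutators are controlled in `potW κ l`, which is `|||·|||_κ` with the weight `κ^|A|`
replaced by `l^|A|`. As operators on disjoint sets of sites commute (`commute_extend`), only
intersecting pairs of sets contribute to a commutator, and summing over the intersection point costs
a factor `|A₁|`. This factor is absorbed by decreasing `l` (`potW_ad_le`); for the term of order `n`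
of the exponential series the decrease is divided into `n` equal portions, which yields `n^n`, and
`n^n / n! ≤ e^n` (`potW_expTerm_le`). Taking `l = κ e^(2^(-r))` after `r` steps leaves a fixed
decrease for each step and never goes below the weight `κ` of the claim. The parameter `κ` of the
weighted operator norm stays the same throughout, since that norm is submultiplicative
(`opNormW_mul_le`) and does not increase under tensoring with the identity (`opNormW_extend_le`).

The start of the iteration needs the bound `κ^(2d+3) M` on the interaction, where `κ^(2d+3)` is
`δ^(-1/4)`: a star has at most `2d+1` sites (`card_nbhd_le`), and a product of two creation or
annihilation operators has at most one nonzero entry in each row and column and changes the weight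
`w^N` by at most `κ²` (`opNormW_cutCore_ladder_mul_le`).
-/

namespace MBL

noncomputable section

variable {d : ℕ}

/-! ### Matrix elements -/

section Matrix

variable {A : Finset (Site d)}

theorem mel_eq_apply (O : Op A) (η η' : Conf A) : mel O η η' = O (ket η') η := by
  classical
  have h := lp.inner_single_left (𝕜 := ℂ) (G := fun _ : Conf A => ℂ) η (1 : ℂ) (O (ket η'))
  simp only [mel, ket] at h ⊢
  rw [h]
  simp

theorem ket_apply (η η' : Conf A) : ket η η' = if η' = η then 1 else 0 := by
  classical
  simp only [ket, lp.single_apply, Pi.single_apply]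

theorem hasSum_ket (f : Hil A) : HasSum (fun ζ => f ζ • ket ζ) f := by
  classical
  have h := lp.hasSum_single (E := fun _ : Conf A => ℂ) (p := 2) (by simp) f
  convert h using 2 with ζ
  ext ξ
  simp [ket_apply, lp.single_apply, Pi.single_apply]

/-- Evaluation at a configuration, as a continuous linear functional. -/
def evalL (η : Conf A) : Hil A →L[ℂ] ℂ := innerSL ℂ (ket η)

theorem evalL_apply (η : Conf A) (f : Hil A) : evalL η f = f η := by
  classical
  have h := lp.inner_single_left (𝕜 := ℂ) (G := fun _ : Conf A => ℂ) η (1 : ℂ) f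
  simp only [evalL, ket, innerSL_apply_apply] at h ⊢
  rw [h]
  simp

theorem mel_eq_evalL (O : Op A) (η η' : Conf A) : mel O η η' = evalL η (O (ket η')) := by
  rw [evalL_apply, mel_eq_apply]

theorem hasSum_mel_apply (O : Op A) (f : Hil A) (η : Conf A) :
    HasSum (fun ζ => f ζ * mel O η ζ) (O f η) := by
  have h := ((hasSum_ket f).mapL O).mapL (evalL η)
  rw [evalL_apply] at h
  convert h using 2 with ζ
  simp [mel_eq_evalL]

/-- A bounded operator is determined by its matrix elements. -/
theorem op_ext {O O' : Op A} (h : ∀ η η', mel O η η' = mel O' η η') : O = O' := by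
  ext f η
  have h1 := hasSum_mel_apply O f η
  have h2 := hasSum_mel_apply O' f η
  simp only [h] at h1
  exact h1.unique h2

theorem hasSum_mel_mul (O O' : Op A) (η η' : Conf A) :
    HasSum (fun ζ => mel O η ζ * mel O' ζ η') (mel (O * O') η η') := by
  have h := hasSum_mel_apply O (O' (ket η')) η
  convert h using 2 with ζ
  · rw [← mel_eq_apply, mul_comm]
  · rw [mel_eq_apply]
    rfl

theorem mel_mul (O O' : Op A) (η η' : Conf A) :
    mel (O * O') η η' = ∑' ζ, mel O η ζ * mel O' ζ η' :=
  (hasSum_mel_mul O O' η η').tsum_eq.symm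

theorem exists_of_mel_mul_ne_zero {O O' : Op A} {η η' : Conf A} (h : mel (O * O') η η' ≠ 0) :
    ∃ ζ, mel O η ζ ≠ 0 ∧ mel O' ζ η' ≠ 0 := by
  by_contra! hc
  apply h
  rw [mel_mul, ← tsum_zero]
  refine tsum_congr fun ζ => ?_
  by_cases h1 : mel O η ζ = 0
  · simp [h1]
  · simp [hc ζ h1]

@[simp] theorem mel_zero (η η' : Conf A) : mel (0 : Op A) η η' = 0 := by simp [mel_eq_evalL]

@[simp] theorem mel_add (O O' : Op A) (η η' : Conf A) :
    mel (O + O') η η' = mel O η η' + mel O' η η' := by simp [mel_eq_evalL]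

@[simp] theorem mel_sub (O O' : Op A) (η η' : Conf A) :
    mel (O - O') η η' = mel O η η' - mel O' η η' := by simp [mel_eq_evalL]

@[simp] theorem mel_neg (O : Op A) (η η' : Conf A) :
    mel (-O) η η' = -mel O η η' := by simp [mel_eq_evalL]

@[simp] theorem mel_smul (c : ℂ) (O : Op A) (η η' : Conf A) :
    mel (c • O) η η' = c * mel O η η' := by simp [mel_eq_evalL]

theorem mel_sum {ι : Type*} (s : Finset ι) (O : ι → Op A) (η η' : Conf A) :
    mel (∑ i ∈ s, O i) η η' = ∑ i ∈ s, mel (O i) η η' := by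
  simp [mel_eq_evalL]

theorem hasSum_mel {ι : Type*} {O : ι → Op A} {P : Op A} (h : HasSum O P) (η η' : Conf A) :
    HasSum (fun i => mel (O i) η η') (mel P η η') := by
  have h1 := (h.mapL (ContinuousLinearMap.apply ℂ (Hil A) (ket η'))).mapL (evalL η)
  simpa [mel_eq_evalL] using h1

theorem ketbra_apply (ξ ξ' : Conf A) (f : Hil A) : ketbra ξ ξ' f = f ξ' • ket ξ := by
  have h := evalL_apply ξ' f
  simp only [evalL] at h
  rw [ketbra, ContinuousLinearMap.smulRight_apply, h]

theorem mel_ketbra (ξ ξ' η η' : Conf A) :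
    mel (ketbra ξ ξ') η η' = if η = ξ ∧ η' = ξ' then 1 else 0 := by
  rw [mel_eq_apply, ketbra_apply]
  simp only [lp.coeFn_smul, Pi.smul_apply, ket_apply, smul_eq_mul]
  split_ifs <;> simp_all

theorem proj_mul_mul_proj (O : Op A) (ξ ξ' : Conf A) :
    proj ξ * O * proj ξ' = mel O ξ ξ' • ketbra ξ ξ' := by
  ext f η
  simp only [proj, mul_apply_eq_comp, ketbra_apply, map_smul, mel_eq_apply,
    smul_apply, lp.coeFn_smul, Pi.smul_apply, smul_eq_mul]
  ring

theorem mel_proj_mul_mul_proj (O : Op A) (ξ ξ' η η' : Conf A) :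
    mel (proj ξ * O * proj ξ') η η' = if η = ξ ∧ η' = ξ' then mel O η η' else 0 := by
  rw [proj_mul_mul_proj, mel_smul, mel_ketbra]
  split_ifs with h
  · simp [h.1, h.2]
  · simp

theorem mel_sum_sum_proj (M : ℝ) (O : Op A) (c : Conf A → Conf A → ℂ) (η η' : Conf A) :
    mel (∑ p ∈ cutConf M A ×ˢ cutConf M A, c p.1 p.2 • (proj p.1 * O * proj p.2)) η η' =
      if η ∈ cutConf M A ∧ η' ∈ cutConf M A then c η η' * mel O η η' else 0 := by
  classical
  rw [mel_sum]
  simp only [mel_smul, mel_proj_mul_mul_proj]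
  have : ∀ p : Conf A × Conf A, (c p.1 p.2 * if η = p.1 ∧ η' = p.2 then mel O η η' else 0) =
      if (η, η') = p then c η η' * mel O η η' else 0 := by
    intro p
    rcases p with ⟨a, b⟩
    by_cases h : (η, η') = (a, b)
    · obtain ⟨rfl, rfl⟩ := Prod.mk.inj h
      simp
    · rw [if_neg h, if_neg (fun h' => h (by rw [h'.1, h'.2])), mul_zero]
  simp only [this, Finset.sum_ite_eq, Finset.mem_product]

theorem mel_cutOp (M : ℝ) (O : Op A) (η η' : Conf A) :
    mel (cutOp M O) η η' = if η ∈ cutConf M A ∧ η' ∈ cutConf M A then mel O η η' else 0 := by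
  have h : cutOp M O =
      ∑ p ∈ cutConf M A ×ˢ cutConf M A, (1 : ℂ) • (proj p.1 * O * proj p.2) := by
    simp only [cutOp, cutProj, Finset.sum_mul, Finset.mul_sum, Finset.sum_product, one_smul]
    exact Finset.sum_comm
  rw [h, mel_sum_sum_proj M O (fun _ _ => 1)]
  simp

theorem mel_resPart (q M δ : ℝ) (𝒜 : Potential d) (η η' : Conf A) :
    mel (resPart q M δ 𝒜 A) η η' =
      if (η ∈ cutConf M A ∧ η' ∈ cutConf M A) ∧ |energy q η - energy q η'| ≤ δ⁻¹ * M
      then mel (𝒜 A) η η' else 0 := by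
  classical
  have h := mel_sum_sum_proj M (𝒜 A)
    (fun η η' => if |energy q η - energy q η'| ≤ δ⁻¹ * M then 1 else 0) η η'
  simp only [ite_smul, one_smul, zero_smul] at h
  rw [ite_and, resPart]
  convert h using 2
  simp

theorem mel_nresPart (q M δ : ℝ) (𝒜 : Potential d) (η η' : Conf A) :
    mel (nresPart q M δ 𝒜 A) η η' =
      if (η ∈ cutConf M A ∧ η' ∈ cutConf M A) ∧ δ⁻¹ * M < |energy q η - energy q η'|
      then mel (𝒜 A) η η' else 0 := by
  classical
  have h := mel_sum_sum_proj M (𝒜 A)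
    (fun η η' => if δ⁻¹ * M < |energy q η - energy q η'| then 1 else 0) η η'
  simp only [ite_smul, one_smul, zero_smul] at h
  rw [ite_and, nresPart]
  convert h using 2
  simp

theorem mel_cutCore (M : ℝ) (T : CoreOp A) (η η' : Conf A) :
    mel (cutCore M T) η η' =
      if η ∈ cutConf M A ∧ η' ∈ cutConf M A then T (Finsupp.single η' 1) η else 0 := by
  classical
  rw [cutCore, ← Finset.sum_product', mel_sum]
  simp only [mel_smul, mel_ketbra]
  have : ∀ p : Conf A × Conf A, ((T (Finsupp.single p.2 1) p.1) *
      if η = p.1 ∧ η' = p.2 then 1 else 0) =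
      if (η, η') = p then T (Finsupp.single η' 1) η else 0 := by
    intro p
    rcases p with ⟨a, b⟩
    by_cases h : (η, η') = (a, b)
    · obtain ⟨rfl, rfl⟩ := Prod.mk.inj h
      simp
    · rw [if_neg h, if_neg (fun h' => h (by rw [h'.1, h'.2])), mul_zero]
  simp only [this, Finset.sum_ite_eq, Finset.mem_product]

end Matrix

/-! ### Operator norms of nonnegative kernels -/

section Kernel

variable {Ω X Y : Type*}

theorem sq_kernel_le_kernelNorm_sq (k : Ω → Ω → ℝ≥0∞) {f : Ω → ℝ≥0∞} (hf : ∑' η, f η ^ 2 ≤ 1) :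
    ∑' η, (∑' η', k η η' * f η') ^ 2 ≤ kernelNorm k ^ 2 := by
  have h : (∑' η, (∑' η', k η η' * f η') ^ 2) ^ (1 / 2 : ℝ) ≤ kernelNorm k :=
    le_iSup₂ (f := fun (f : Ω → ℝ≥0∞) (_ : ∑' η, f η ^ 2 ≤ 1) =>
      (∑' η, (∑' η', k η η' * f η') ^ 2) ^ (1 / 2 : ℝ)) f hf
  have h2 := ENNReal.rpow_le_rpow h (z := 2) (by norm_num)
  rw [← ENNReal.rpow_mul] at h2
  norm_num at h2
  exact h2

theorem kernelNorm_le {k : Ω → Ω → ℝ≥0∞} {c : ℝ≥0∞}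
    (h : ∀ f : Ω → ℝ≥0∞, ∑' η, f η ^ 2 ≤ 1 → ∑' η, (∑' η', k η η' * f η') ^ 2 ≤ c ^ 2) :
    kernelNorm k ≤ c := by
  refine iSup₂_le fun f hf => ?_
  have h2 := ENNReal.rpow_le_rpow (h f hf) (z := 1 / 2) (by norm_num)
  refine h2.trans_eq ?_
  rw [← ENNReal.rpow_natCast, ← ENNReal.rpow_mul]
  norm_num

theorem le_kernelNorm (k : Ω → Ω → ℝ≥0∞) (η η' : Ω) : k η η' ≤ kernelNorm k := by
  classical
  have h := sq_kernel_le_kernelNorm_sq k (f := Pi.single η' 1) (by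
    rw [tsum_eq_single η' (fun b hb => by simp [hb])]
    simp)
  have h1 : ∀ η, ∑' ζ, k η ζ * (Pi.single η' 1 : Ω → ℝ≥0∞) ζ = k η η' := by
    intro η
    rw [tsum_eq_single η' (fun b hb => by simp [hb])]
    simp
  simp only [h1] at h
  exact (ENNReal.pow_le_pow_left_iff two_ne_zero).1
    ((ENNReal.le_tsum (f := fun η => k η η' ^ 2) η).trans h)

/-- The bound defining `kernelNorm`, for vectors of arbitrary (also infinite) norm. -/
theorem tsum_sq_le_kernelNorm_mul (k : Ω → Ω → ℝ≥0∞) (f : Ω → ℝ≥0∞) :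
    ∑' η, (∑' η', k η η' * f η') ^ 2 ≤ kernelNorm k ^ 2 * ∑' η, f η ^ 2 := by
  rcases eq_or_ne (∑' η, f η ^ 2) 0 with h0 | h0
  · have hf : ∀ η, f η = 0 := fun η => by simpa using (ENNReal.tsum_eq_zero.1 h0) η
    simp [hf]
  rcases eq_or_ne (∑' η, f η ^ 2) ⊤ with ht | ht
  · rcases eq_or_ne (kernelNorm k) 0 with hk | hk
    · have : ∀ η η', k η η' = 0 := fun η η' => by
        simpa [hk] using le_kernelNorm k η η'
      simp [this]
    · rw [ht, ENNReal.mul_top (by simpa using hk)]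
      exact le_top
  set s := (∑' η, f η ^ 2) ^ (1 / 2 : ℝ) with hs
  have hs2 : s ^ 2 = ∑' η, f η ^ 2 := by
    rw [hs, ← ENNReal.rpow_natCast, ← ENNReal.rpow_mul]
    norm_num
  have hs0 : s ≠ 0 := fun h => h0 (by rw [← hs2, h]; simp)
  have hst : s ≠ ⊤ := fun h => ht (by rw [← hs2, h]; simp)
  have h := sq_kernel_le_kernelNorm_sq k (f := fun η => s⁻¹ * f η) (by
    simp only [mul_pow]
    rw [ENNReal.tsum_mul_left, ← hs2, ← mul_pow, ENNReal.inv_mul_cancel hs0 hst, one_pow])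
  have h1 : ∀ η, ∑' η', k η η' * (s⁻¹ * f η') = s⁻¹ * ∑' η', k η η' * f η' := by
    intro η
    rw [← ENNReal.tsum_mul_left]
    exact tsum_congr fun _ => by ring
  simp only [h1, mul_pow] at h
  rw [ENNReal.tsum_mul_left] at h
  rw [← hs2]
  calc _ = s ^ 2 * (s⁻¹ ^ 2 * ∑' η, (∑' η', k η η' * f η') ^ 2) := by
        rw [← mul_assoc, ← mul_pow, ENNReal.mul_inv_cancel hs0 hst, one_pow, one_mul]
    _ ≤ s ^ 2 * kernelNorm k ^ 2 := by gcongr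
    _ = _ := mul_comm _ _

theorem kernelNorm_mono {k k' : Ω → Ω → ℝ≥0∞} (h : ∀ η η', k η η' ≤ k' η η') :
    kernelNorm k ≤ kernelNorm k' :=
  kernelNorm_le fun _ hf => le_trans
    (ENNReal.tsum_le_tsum fun η => pow_le_pow_left' (ENNReal.tsum_le_tsum fun η' =>
      mul_le_mul_left (h η η') _) 2)
    (sq_kernel_le_kernelNorm_sq k' hf)

theorem kernelNorm_mul_left (c : ℝ≥0∞) (k : Ω → Ω → ℝ≥0∞) :
    kernelNorm (fun η η' => c * k η η') ≤ c * kernelNorm k := by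
  refine kernelNorm_le fun f hf => ?_
  simp only [mul_assoc, ENNReal.tsum_mul_left, mul_pow]
  gcongr
  exact sq_kernel_le_kernelNorm_sq k hf

/-- Minkowski's inequality in `ℓ²` for two summands, for functions with values in `[0, ∞]`. -/
theorem rpow_half_tsum_add_sq_le (f g : Ω → ℝ≥0∞) :
    (∑' η, (f η + g η) ^ 2) ^ (1 / 2 : ℝ) ≤
      (∑' η, f η ^ 2) ^ (1 / 2 : ℝ) + (∑' η, g η ^ 2) ^ (1 / 2 : ℝ) := by
  let _ : MeasurableSpace Ω := ⊤
  have h := ENNReal.lintegral_Lp_add_le (μ := MeasureTheory.Measure.count) (p := 2)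
    (f := f) (g := g) (measurable_from_top.aemeasurable) (measurable_from_top.aemeasurable) (by norm_num)
  simp only [Pi.add_apply, MeasureTheory.lintegral_count] at h
  simpa using h

theorem kernelNorm_add_le (k k' : Ω → Ω → ℝ≥0∞) :
    kernelNorm (fun η η' => k η η' + k' η η') ≤ kernelNorm k + kernelNorm k' := by
  refine iSup₂_le fun f hf => ?_
  simp only [add_mul, ENNReal.tsum_add]
  refine (rpow_half_tsum_add_sq_le _ _).trans (add_le_add ?_ ?_)
  · exact le_iSup₂ (f := fun (f : Ω → ℝ≥0∞) (_ : ∑' η, f η ^ 2 ≤ 1) =>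
      (∑' η, (∑' η', k η η' * f η') ^ 2) ^ (1 / 2 : ℝ)) f hf
  · exact le_iSup₂ (f := fun (f : Ω → ℝ≥0∞) (_ : ∑' η, f η ^ 2 ≤ 1) =>
      (∑' η, (∑' η', k' η η' * f η') ^ 2) ^ (1 / 2 : ℝ)) f hf

theorem kernelNorm_comp_le (k k' : Ω → Ω → ℝ≥0∞) :
    kernelNorm (fun η η' => ∑' ζ, k η ζ * k' ζ η') ≤ kernelNorm k * kernelNorm k' := by
  refine kernelNorm_le fun f hf => ?_
  have h1 : ∀ η, ∑' η', (∑' ζ, k η ζ * k' ζ η') * f η' = ∑' ζ, k η ζ * ∑' η', k' ζ η' * f η' := by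
    intro η
    simp only [← ENNReal.tsum_mul_left, ← ENNReal.tsum_mul_right]
    rw [ENNReal.tsum_comm]
    exact tsum_congr fun _ => tsum_congr fun _ => mul_assoc _ _ _
  simp only [h1]
  refine (tsum_sq_le_kernelNorm_mul k _).trans ?_
  rw [mul_pow]
  gcongr
  exact sq_kernel_le_kernelNorm_sq k' hf

/-- The norm of `k ⊗ 1` is at most the norm of `k`. -/
theorem kernelNorm_tensor_le (e : Ω ≃ X × Y) (k : X → X → ℝ≥0∞) :
    kernelNorm (fun η η' : Ω => open Classical in
      if (e η).2 = (e η').2 then k (e η).1 (e η').1 else 0) ≤ kernelNorm k := by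
  classical
  refine kernelNorm_le fun f hf => ?_
  have h1 : ∀ η, ∑' η', (if (e η).2 = (e η').2 then k (e η).1 (e η').1 else 0) * f η' =
      ∑' x, k (e η).1 x * f (e.symm (x, (e η).2)) := by
    intro η
    rw [← e.symm.tsum_eq, ENNReal.tsum_prod']
    refine tsum_congr fun x => ?_
    rw [tsum_eq_single (e η).2]
    · simp
    · intro y hy
      simp [hy.symm]
  simp only [h1]
  rw [← e.symm.tsum_eq, ENNReal.tsum_prod', ENNReal.tsum_comm]
  simp only [Equiv.apply_symm_apply]
  calc _ ≤ ∑' y, kernelNorm k ^ 2 * ∑' x, f (e.symm (x, y)) ^ 2 :=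
        ENNReal.tsum_le_tsum fun y => tsum_sq_le_kernelNorm_mul k _
    _ = kernelNorm k ^ 2 * ∑' η, f η ^ 2 := by
        rw [ENNReal.tsum_mul_left, ← e.symm.tsum_eq, ENNReal.tsum_prod', ENNReal.tsum_comm]
    _ ≤ kernelNorm k ^ 2 := mul_le_of_le_one_right' hf

/-- A kernel with at most one nonzero entry in each row and column is bounded by its largest
entry. -/
theorem kernelNorm_le_of_subsingleton {k : Ω → Ω → ℝ≥0∞} {c : ℝ≥0∞} (hc : ∀ η η', k η η' ≤ c)
    (hrow : ∀ η ξ ξ', k η ξ ≠ 0 → k η ξ' ≠ 0 → ξ = ξ')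
    (hcol : ∀ η ξ ξ', k ξ η ≠ 0 → k ξ' η ≠ 0 → ξ = ξ') : kernelNorm k ≤ c := by
  have single : ∀ (g : Ω → ℝ≥0∞), (∀ ξ ξ', g ξ ≠ 0 → g ξ' ≠ 0 → ξ = ξ') →
      (∀ s, (∀ ξ, g ξ ^ 2 ≤ s) → ∑' ξ, g ξ ^ 2 ≤ s) ∧ (∑' ξ, g ξ) ^ 2 = ∑' ξ, g ξ ^ 2 := by
    intro g hg
    by_cases h : ∃ ξ, g ξ ≠ 0
    · obtain ⟨ξ, hξ⟩ := h
      have h0 : ∀ ξ', ξ' ≠ ξ → g ξ' = 0 := fun ξ' hne => by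
        by_contra h'
        exact hne (hg _ _ h' hξ)
      rw [tsum_eq_single ξ h0, tsum_eq_single ξ (fun ξ' h' => by simp [h0 ξ' h'])]
      exact ⟨fun s hs => hs ξ, rfl⟩
    · push Not at h
      simp [h]
  refine kernelNorm_le fun f hf => ?_
  have h1 : ∀ η, (∑' η', k η η' * f η') ^ 2 = ∑' η', (k η η' * f η') ^ 2 := fun η =>
    (single (fun η' => k η η' * f η') (fun ξ ξ' h h' =>
      hrow η ξ ξ' (left_ne_zero_of_mul h) (left_ne_zero_of_mul h'))).2
  simp only [h1, mul_pow]
  rw [ENNReal.tsum_comm]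
  simp only [ENNReal.tsum_mul_right]
  calc _ ≤ ∑' η', c ^ 2 * f η' ^ 2 := ENNReal.tsum_le_tsum fun η' => by
        gcongr
        exact (single (fun η => k η η') (hcol η')).1 _ fun η => by gcongr; exact hc _ _
    _ ≤ c ^ 2 := by
        rw [ENNReal.tsum_mul_left]
        exact mul_le_of_le_one_right' hf

end Kernel

section KernelSums

variable {Ω : Type*}

theorem kernelNorm_sum_le {ι : Type*} (s : Finset ι) (k : ι → Ω → Ω → ℝ≥0∞) :
    kernelNorm (fun η η' => ∑ i ∈ s, k i η η') ≤ ∑ i ∈ s, kernelNorm (k i) := by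
  classical
  induction s using Finset.induction_on with
  | empty => exact (kernelNorm_le (c := 0) fun f _ => by simp).trans (by simp)
  | insert a s ha ih =>
    simp only [Finset.sum_insert ha]
    exact (kernelNorm_add_le _ _).trans (by gcongr)

theorem kernelNorm_tsum_le (k : ℕ → Ω → Ω → ℝ≥0∞) :
    kernelNorm (fun η η' => ∑' n, k n η η') ≤ ∑' n, kernelNorm (k n) := by
  refine kernelNorm_le fun f hf => ?_
  have h1 : ∀ η, ∑' η', (∑' n, k n η η') * f η' = ∑' n, ∑' η', k n η η' * f η' := by
    intro η
    simp only [← ENNReal.tsum_mul_right]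
    exact ENNReal.tsum_comm
  simp only [h1]
  rw [ENNReal.tsum_eq_iSup_sum]
  refine iSup_le fun s => ?_
  have ht : Filter.Tendsto (fun N => ∑ η ∈ s, (∑ n ∈ Finset.range N, ∑' η', k n η η' * f η') ^ 2)
      Filter.atTop (nhds (∑ η ∈ s, (∑' n, ∑' η', k n η η' * f η') ^ 2)) :=
    tendsto_finsetSum _ fun η _ =>
      ((ENNReal.continuous_pow 2).tendsto _).comp (ENNReal.tendsto_nat_tsum _)
  refine le_of_tendsto' ht fun N => ?_
  calc _ ≤ ∑' η, (∑ n ∈ Finset.range N, ∑' η', k n η η' * f η') ^ 2 := ENNReal.sum_le_tsum s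
    _ = ∑' η, (∑' η', (∑ n ∈ Finset.range N, k n η η') * f η') ^ 2 := by
        refine tsum_congr fun η => ?_
        simp only [Finset.sum_mul]
        rw [Summable.tsum_finsetSum fun _ _ => ENNReal.summable]
    _ ≤ kernelNorm (fun η η' => ∑ n ∈ Finset.range N, k n η η') ^ 2 :=
        sq_kernel_le_kernelNorm_sq _ hf
    _ ≤ _ := by
        gcongr
        exact (kernelNorm_sum_le _ _).trans (ENNReal.sum_le_tsum _)

end KernelSums

/-! ### Weighted operator norms -/

section OpNormW

variable {A : Finset (Site d)} {κ : ℝ}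

/-- The weight `w^N` at the configuration `η`. -/
def weight (w : A → ℝ) (η : Conf A) : ℝ := ∏ x, w x ^ η x

theorem weight_pos (hκ : 0 < κ) {w : A → ℝ} (hw : ∀ x, κ⁻¹ ≤ w x ∧ w x ≤ κ) (η : Conf A) :
    0 < weight w η :=
  Finset.prod_pos fun x _ => pow_pos ((inv_pos.2 hκ).trans_le (hw x).1) _

/-- The matrix elements of `w^N Ŏ w^(-N)`. -/
def wKernel (w : A → ℝ) (O : Op A) (η η' : Conf A) : ℝ≥0∞ :=
  ENNReal.ofReal (weight w η * ‖mel O η η'‖ * (weight w η')⁻¹)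

theorem kernelNorm_wKernel_le {w : A → ℝ} (hw : ∀ x, κ⁻¹ ≤ w x ∧ w x ≤ κ) (O : Op A) :
    kernelNorm (wKernel w O) ≤ opNormW κ O :=
  le_iSup₂ (f := fun (w : A → ℝ) (_ : ∀ x, κ⁻¹ ≤ w x ∧ w x ≤ κ) => kernelNorm (wKernel w O)) w hw

theorem opNormW_le {O : Op A} {c : ℝ≥0∞}
    (h : ∀ w : A → ℝ, (∀ x, κ⁻¹ ≤ w x ∧ w x ≤ κ) → kernelNorm (wKernel w O) ≤ c) :
    opNormW κ O ≤ c := iSup₂_le h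

theorem wKernel_eq (hκ : 0 < κ) {w : A → ℝ} (hw : ∀ x, κ⁻¹ ≤ w x ∧ w x ≤ κ) (O : Op A)
    (η η' : Conf A) :
    wKernel w O η η' = ENNReal.ofReal (weight w η * (weight w η')⁻¹) * ‖mel O η η'‖ₑ := by
  have h1 := weight_pos hκ hw η
  have h2 := weight_pos hκ hw η'
  rw [wKernel, ← ofReal_norm, ← ENNReal.ofReal_mul (by positivity)]
  congr 1
  ring

theorem opNormW_le_of_enorm_mel_le (hκ : 0 < κ) {O O' : Op A} {c : ℝ≥0∞}
    (h : ∀ η η', ‖mel O η η'‖ₑ ≤ c * ‖mel O' η η'‖ₑ) : opNormW κ O ≤ c * opNormW κ O' := by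
  refine opNormW_le fun w hw => ?_
  calc kernelNorm (wKernel w O) ≤ kernelNorm (fun η η' => c * wKernel w O' η η') := by
        refine kernelNorm_mono fun η η' => ?_
        rw [wKernel_eq hκ hw, wKernel_eq hκ hw, mul_left_comm]
        gcongr
        exact h η η'
    _ ≤ c * kernelNorm (wKernel w O') := kernelNorm_mul_left _ _
    _ ≤ _ := by gcongr; exact kernelNorm_wKernel_le hw O'

theorem opNormW_mono (hκ : 0 < κ) {O O' : Op A}
    (h : ∀ η η', ‖mel O η η'‖ₑ ≤ ‖mel O' η η'‖ₑ) : opNormW κ O ≤ opNormW κ O' := by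
  simpa using opNormW_le_of_enorm_mel_le hκ (c := 1) (by simpa using h)

theorem opNormW_smul_le (hκ : 0 < κ) (c : ℂ) (O : Op A) :
    opNormW κ (c • O) ≤ ‖c‖ₑ * opNormW κ O :=
  opNormW_le_of_enorm_mel_le hκ fun η η' => by rw [mel_smul, enorm_mul]

theorem opNormW_zero (hκ : 0 < κ) : opNormW κ (0 : Op A) = 0 := by
  simpa using opNormW_smul_le hκ (0 : ℂ) (0 : Op A)

theorem opNormW_add_le (hκ : 0 < κ) (O O' : Op A) :
    opNormW κ (O + O') ≤ opNormW κ O + opNormW κ O' := by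
  refine opNormW_le fun w hw => ?_
  calc kernelNorm (wKernel w (O + O'))
      ≤ kernelNorm (fun η η' => wKernel w O η η' + wKernel w O' η η') := by
        refine kernelNorm_mono fun η η' => ?_
        rw [wKernel_eq hκ hw, wKernel_eq hκ hw, wKernel_eq hκ hw, ← mul_add, mel_add]
        gcongr
        exact enorm_add_le _ _
    _ ≤ _ := (kernelNorm_add_le _ _).trans
        (add_le_add (kernelNorm_wKernel_le hw O) (kernelNorm_wKernel_le hw O'))

theorem opNormW_neg (hκ : 0 < κ) (O : Op A) : opNormW κ (-O) = opNormW κ O :=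
  le_antisymm (opNormW_mono hκ fun η η' => by simp) (opNormW_mono hκ fun η η' => by simp)

theorem opNormW_sub_le (hκ : 0 < κ) (O O' : Op A) :
    opNormW κ (O - O') ≤ opNormW κ O + opNormW κ O' := by
  rw [sub_eq_add_neg, ← opNormW_neg hκ O']
  exact opNormW_add_le hκ _ _

theorem opNormW_sum_le (hκ : 0 < κ) {ι : Type*} (s : Finset ι) (O : ι → Op A) :
    opNormW κ (∑ i ∈ s, O i) ≤ ∑ i ∈ s, opNormW κ (O i) := by
  classical
  induction s using Finset.induction_on with
  | empty => simp [opNormW_zero hκ]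
  | insert a s ha ih =>
    rw [Finset.sum_insert ha, Finset.sum_insert ha]
    exact (opNormW_add_le hκ _ _).trans (by gcongr)

theorem opNormW_le_tsum (hκ : 0 < κ) {O : ℕ → Op A} {P : Op A} (h : HasSum O P) :
    opNormW κ P ≤ ∑' n, opNormW κ (O n) := by
  refine opNormW_le fun w hw => ?_
  calc kernelNorm (wKernel w P) ≤ kernelNorm (fun η η' => ∑' n, wKernel w (O n) η η') := by
        refine kernelNorm_mono fun η η' => ?_
        simp only [wKernel_eq hκ hw]
        rw [ENNReal.tsum_mul_left, ← (hasSum_mel h η η').tsum_eq]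
        gcongr
        exact enorm_tsum_le_tsum_enorm
    _ ≤ _ := (kernelNorm_tsum_le _).trans
        (ENNReal.tsum_le_tsum fun n => kernelNorm_wKernel_le hw (O n))

theorem opNormW_mul_le (hκ : 0 < κ) (O O' : Op A) :
    opNormW κ (O * O') ≤ opNormW κ O * opNormW κ O' := by
  refine opNormW_le fun w hw => ?_
  calc kernelNorm (wKernel w (O * O'))
      ≤ kernelNorm (fun η η' => ∑' ζ, wKernel w O η ζ * wKernel w O' ζ η') := by
        refine kernelNorm_mono fun η η' => ?_
        have h : ∀ ζ, wKernel w O η ζ * wKernel w O' ζ η' =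
            ENNReal.ofReal (weight w η * (weight w η')⁻¹) * ‖mel O η ζ * mel O' ζ η'‖ₑ := by
          intro ζ
          have h1 := weight_pos hκ hw η
          have h2 := weight_pos hκ hw η'
          have h3 := weight_pos hκ hw ζ
          rw [wKernel_eq hκ hw, wKernel_eq hκ hw, mul_mul_mul_comm, ← enorm_mul,
            ← ENNReal.ofReal_mul (by positivity)]
          congr 2
          field_simp
        simp only [h]
        rw [ENNReal.tsum_mul_left, wKernel_eq hκ hw, mel_mul]
        gcongr
        exact enorm_tsum_le_tsum_enorm
    _ ≤ _ := (kernelNorm_comp_le _ _).trans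
        (mul_le_mul' (kernelNorm_wKernel_le hw O) (kernelNorm_wKernel_le hw O'))

theorem opNormW_commutator_le (hκ : 0 < κ) (O O' : Op A) :
    opNormW κ ⁅O, O'⁆ ≤ 2 * (opNormW κ O * opNormW κ O') := by
  rw [Ring.lie_def, two_mul]
  refine (opNormW_sub_le hκ _ _).trans (add_le_add (opNormW_mul_le hκ _ _) ?_)
  rw [mul_comm (opNormW κ O)]
  exact opNormW_mul_le hκ _ _

/-- The weight `w = 1` shows that the weighted norm dominates the operator norm. -/
theorem enorm_le_opNormW (hκ : 1 ≤ κ) (O : Op A) : ‖O‖ₑ ≤ opNormW κ O := by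
  have hw : ∀ x : A, κ⁻¹ ≤ (1 : A → ℝ) x ∧ (1 : A → ℝ) x ≤ κ :=
    fun x => ⟨inv_le_one_of_one_le₀ hκ, hκ⟩
  have hk : ∀ η η', wKernel 1 O η η' = ‖mel O η η'‖ₑ := fun η η' => by
    rw [wKernel_eq (zero_lt_one.trans_le hκ) hw]
    simp [weight]
  rcases eq_or_ne (opNormW κ O) ⊤ with ht | ht
  · rw [ht]
    exact le_top
  have hb : ∀ f : Hil A, ‖O f‖ₑ ≤ opNormW κ O * ‖f‖ₑ := by
    intro f
    refine (ENNReal.pow_le_pow_left_iff two_ne_zero).1 ?_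
    rw [← tsum_enorm_sq, mul_pow, ← tsum_enorm_sq]
    calc ∑' η, ‖O f η‖ₑ ^ 2 ≤ ∑' η, (∑' η', wKernel 1 O η η' * ‖f η'‖ₑ) ^ 2 := by
          refine ENNReal.tsum_le_tsum fun η => ?_
          gcongr
          rw [← (hasSum_mel_apply O f η).tsum_eq]
          refine enorm_tsum_le_tsum_enorm.trans_eq (tsum_congr fun η' => ?_)
          rw [hk, enorm_mul, mul_comm]
      _ ≤ kernelNorm (wKernel 1 O) ^ 2 * ∑' η, ‖f η‖ₑ ^ 2 := tsum_sq_le_kernelNorm_mul _ _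
      _ ≤ _ := by gcongr; exact kernelNorm_wKernel_le hw O
  rw [← ofReal_norm]
  refine ENNReal.ofReal_le_of_le_toReal (O.opNorm_le_bound ENNReal.toReal_nonneg fun f => ?_)
  have h := ENNReal.toReal_mono (by finiteness) (hb f)
  simpa using h

end OpNormW

/-! ### Tensoring with the identity -/

section Extend

variable {A B : Finset (Site d)} {κ : ℝ}

/-- The restriction of a configuration to a smaller volume. -/
def resConf (h : B ⊆ A) (η : Conf A) : Conf B := fun x => η ⟨x.1, h x.2⟩

theorem mel_extend_eq (h : B ⊆ A) (O : Op B) (η η' : Conf A) :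
    mel (extend h O) η η' = open Classical in
      if (splitConf h η).2 = (splitConf h η').2 then
        mel O (splitConf h η).1 (splitConf h η').1 else 0 := by
  classical
  have h1 : slice (splitConf h) (splitConf h η).2 (ket η') =
      if (splitConf h η).2 = (splitConf h η').2 then ket (splitConf h η').1 else 0 := by
    ext x
    have h2 : slice (splitConf h) (splitConf h η).2 (ket η') x =
      ket η' ((splitConf h).symm (x, (splitConf h η).2)) := rfl
    rw [h2, ket_apply]
    by_cases hy : (splitConf h η).2 = (splitConf h η').2
    · rw [if_pos hy, ket_apply, hy]
      have : (splitConf h).symm (x, (splitConf h η').2) = η' ↔ x = (splitConf h η').1 := by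
        rw [Equiv.symm_apply_eq, Prod.ext_iff]
        simp
      simp only [this]
    · rw [if_neg hy, if_neg]
      · rfl
      · rw [Equiv.symm_apply_eq, Prod.ext_iff]
        exact fun h => hy h.2
  have h3 : extend h O (ket η') η =
    O (slice (splitConf h) (splitConf h η).2 (ket η')) (splitConf h η).1 := rfl
  rw [mel_eq_apply, h3, h1]
  split_ifs
  · rw [mel_eq_apply]
  · simp

theorem mel_extend (h : B ⊆ A) (O : Op B) (η η' : Conf A) :
    mel (extend h O) η η' = open Classical in
      if ∀ x : A, x.1 ∉ B → η x = η' x then mel O (resConf h η) (resConf h η') else 0 := by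
  classical
  rw [mel_extend_eq]
  have : (splitConf h η).2 = (splitConf h η').2 ↔ ∀ x : A, x.1 ∉ B → η x = η' x := by
    rw [funext_iff, Subtype.forall]
    rfl
  simp only [this]
  rfl

theorem mel_extend_ne_zero {h : B ⊆ A} {O : Op B} {η η' : Conf A}
    (hne : mel (extend h O) η η' ≠ 0) :
    (∀ x : A, x.1 ∉ B → η x = η' x) ∧ mel O (resConf h η) (resConf h η') ≠ 0 := by
  rw [mel_extend] at hne
  split_ifs at hne with h1
  exacts [⟨h1, hne⟩, (hne rfl).elim]

theorem extend_add (h : B ⊆ A) (O O' : Op B) : extend h (O + O') = extend h O + extend h O' := by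
  refine op_ext fun η η' => ?_
  simp only [mel_extend, mel_add]
  split_ifs <;> simp

theorem extend_smul (h : B ⊆ A) (c : ℂ) (O : Op B) : extend h (c • O) = c • extend h O := by
  refine op_ext fun η η' => ?_
  simp only [mel_extend, mel_smul]
  split_ifs <;> simp

@[simp] theorem extend_zero (h : B ⊆ A) : extend h (0 : Op B) = 0 :=
  op_ext fun η η' => by simp [mel_extend]

theorem extend_self (h : A ⊆ A) (O : Op A) : extend h O = O := by
  refine op_ext fun η η' => ?_
  rw [mel_extend, if_pos fun x hx => (hx x.2).elim]
  rfl

theorem weight_eq_mul (h : B ⊆ A) (w : A → ℝ) (η : Conf A) :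
    weight w η = weight (fun x : B => w ⟨x.1, h x.2⟩) (splitConf h η).1 *
      ∏ x : {x : A // x.1 ∉ B}, w x.1 ^ (splitConf h η).2 x := by
  classical
  rw [weight, ← Fintype.prod_subtype_mul_prod_subtype (fun x : A => x.1 ∈ B)]
  congr 1
  exact Fintype.prod_equiv
    { toFun := fun x => (⟨x.1.1, x.2⟩ : B)
      invFun := fun x => ⟨⟨x.1, h x.2⟩, x.2⟩
      left_inv := fun _ => rfl
      right_inv := fun _ => rfl } _ _ fun x => rfl

theorem opNormW_extend_le (hκ : 0 < κ) (h : B ⊆ A) (O : Op B) :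
    opNormW κ (extend h O) ≤ opNormW κ O := by
  classical
  refine opNormW_le fun w hw => ?_
  set w' : B → ℝ := fun x => w ⟨x.1, h x.2⟩ with hw'
  have hwB : ∀ x, κ⁻¹ ≤ w' x ∧ w' x ≤ κ := fun x => hw _
  refine le_trans (le_of_eq ?_) ((kernelNorm_tensor_le (splitConf h) (wKernel w' O)).trans
    (kernelNorm_wKernel_le hwB O))
  congr 1
  funext η η'
  rw [wKernel_eq hκ hw, mel_extend_eq]
  by_cases he : (splitConf h η).2 = (splitConf h η').2
  · rw [if_pos he, if_pos he, wKernel_eq hκ hwB]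
    congr 2
    have h1 : 0 < ∏ x : {x : A // x.1 ∉ B}, w x.1 ^ (splitConf h η').2 x :=
      Finset.prod_pos fun x _ => pow_pos ((inv_pos.2 hκ).trans_le (hw _).1) _
    have h2 := weight_pos hκ hwB (splitConf h η').1
    have e1 : weight w η = weight w' _ * _ := weight_eq_mul h w η
    have e2 : weight w η' = weight w' _ * _ := weight_eq_mul h w η'
    rw [e1, e2, he]
    field_simp
  · rw [if_neg he, if_neg he]
    simp

/-- Operators acting on disjoint sets of sites commute. -/
theorem commute_extend {A₁ A₂ : Finset (Site d)} (h₁ : A₁ ⊆ A) (h₂ : A₂ ⊆ A) (hd : Disjoint A₁ A₂)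
    (O₁ : Op A₁) (O₂ : Op A₂) : extend h₁ O₁ * extend h₂ O₂ = extend h₂ O₂ * extend h₁ O₁ := by
  classical
  -- The only intermediate configuration changes `η'` into `η` on the sites of the second factor.
  have key : ∀ {B₁ B₂ : Finset (Site d)} (k₁ : B₁ ⊆ A) (k₂ : B₂ ⊆ A) (_ : Disjoint B₁ B₂)
      (P₁ : Op B₁) (P₂ : Op B₂) (η η' : Conf A), mel (extend k₁ P₁ * extend k₂ P₂) η η' =
        if ∀ x : A, x.1 ∉ B₁ → x.1 ∉ B₂ → η x = η' x then
          mel P₁ (resConf k₁ η) (resConf k₁ η') * mel P₂ (resConf k₂ η) (resConf k₂ η')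
        else 0 := by
    intro B₁ B₂ k₁ k₂ hB P₁ P₂ η η'
    set ζ₀ : Conf A := fun x => if x.1 ∈ B₁ then η' x else η x with hζ
    rw [mel_mul, tsum_eq_single ζ₀]
    · have e1 : resConf k₁ ζ₀ = resConf k₁ η' := by
        funext x
        simp [resConf, hζ]
      have e2 : resConf k₂ ζ₀ = resConf k₂ η := by
        funext x
        have : x.1 ∉ B₁ := fun hx => Finset.disjoint_left.1 hB hx x.2
        simp [resConf, hζ, this]
      have e3 : ∀ x : A, x.1 ∉ B₁ → η x = ζ₀ x := fun x hx => by simp [hζ, hx]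
      have e4 : (∀ x : A, x.1 ∉ B₂ → ζ₀ x = η' x) ↔
          ∀ x : A, x.1 ∉ B₁ → x.1 ∉ B₂ → η x = η' x := by
        refine forall_congr' fun x => ?_
        by_cases hx : x.1 ∈ B₁ <;> simp [hζ, hx]
      rw [mel_extend, mel_extend, if_pos e3, e1, e2]
      simp only [e4]
      split_ifs <;> simp
    · intro ζ hne
      by_contra h0
      obtain ⟨a1, -⟩ := mel_extend_ne_zero (left_ne_zero_of_mul h0)
      obtain ⟨a2, -⟩ := mel_extend_ne_zero (right_ne_zero_of_mul h0)
      apply hne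
      funext x
      by_cases hx : x.1 ∈ B₁
      · simp only [hζ, hx, if_true]
        exact a2 x (Finset.disjoint_left.1 hB hx)
      · simp only [hζ, hx, if_false]
        exact (a1 x hx).symm
  refine op_ext fun η η' => ?_
  rw [key h₁ h₂ hd, key h₂ h₁ hd.symm, mul_comm (mel O₁ _ _)]
  have : (∀ x : A, x.1 ∉ A₁ → x.1 ∉ A₂ → η x = η' x) ↔
      ∀ x : A, x.1 ∉ A₂ → x.1 ∉ A₁ → η x = η' x :=
    forall_congr' fun x => forall_comm
  simp only [this]

end Extend

/-! ### Sums over sets of sites anchored at a point -/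

section Anchored

/-- `∑_{A ∋ x} l^|A| b(A)`. -/
def anchoredSum (l : ℝ≥0∞) (b : Finset (Site d) → ℝ≥0∞) (x : Site d) : ℝ≥0∞ :=
  ∑' A : Finset (Site d), if x ∈ A then l ^ A.card * b A else 0

/-- `sup_x ∑_{A ∋ x} l^|A| b(A)`. -/
def anchoredSup (l : ℝ≥0∞) (b : Finset (Site d) → ℝ≥0∞) : ℝ≥0∞ := ⨆ x, anchoredSum l b x

/-- The sum of `a(A₁) b(A₂)` over the pairs of intersecting sets with union `A`: it dominates the
commutator of two potentials, as operators acting on disjoint sets of sites commute. -/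
def unionConv (a b : Finset (Site d) → ℝ≥0∞) (A : Finset (Site d)) : ℝ≥0∞ :=
  ∑' A₁ : Finset (Site d), ∑' A₂ : Finset (Site d),
    if A₁ ∪ A₂ = A ∧ ¬ Disjoint A₁ A₂ then a A₁ * b A₂ else 0

theorem anchoredSum_le (l : ℝ≥0∞) (b : Finset (Site d) → ℝ≥0∞) (x : Site d) :
    anchoredSum l b x ≤ anchoredSup l b := le_iSup (anchoredSum l b) x

theorem anchoredSup_mono {l l' : ℝ≥0∞} (hl : l ≤ l') {b b' : Finset (Site d) → ℝ≥0∞}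
    (hb : ∀ A, b A ≤ b' A) : anchoredSup l b ≤ anchoredSup l' b' := by
  refine iSup_mono fun x => ENNReal.tsum_le_tsum fun A => ?_
  split_ifs
  · exact mul_le_mul' (pow_le_pow_left' hl _) (hb A)
  · exact le_rfl

theorem anchoredSup_mul_left (l c : ℝ≥0∞) (b : Finset (Site d) → ℝ≥0∞) :
    anchoredSup l (fun A => c * b A) = c * anchoredSup l b := by
  rw [anchoredSup, anchoredSup, ENNReal.mul_iSup]
  refine iSup_congr fun x => ?_
  rw [anchoredSum, anchoredSum, ← ENNReal.tsum_mul_left]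
  refine tsum_congr fun A => ?_
  split_ifs
  · ring
  · simp

theorem anchoredSup_add_le (l : ℝ≥0∞) (b b' : Finset (Site d) → ℝ≥0∞) :
    anchoredSup l (fun A => b A + b' A) ≤ anchoredSup l b + anchoredSup l b' := by
  refine iSup_le fun x => ?_
  refine le_trans (le_of_eq ?_) (add_le_add (anchoredSum_le l b x) (anchoredSum_le l b' x))
  rw [anchoredSum, anchoredSum, anchoredSum, ← ENNReal.tsum_add]
  refine tsum_congr fun A => ?_
  split_ifs
  · ring
  · simp

theorem anchoredSup_tsum_le (l : ℝ≥0∞) (b : ℕ → Finset (Site d) → ℝ≥0∞) :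
    anchoredSup l (fun A => ∑' n, b n A) ≤ ∑' n, anchoredSup l (b n) := by
  refine iSup_le fun x => ?_
  refine le_trans (le_of_eq ?_) (ENNReal.tsum_le_tsum fun n => anchoredSum_le l (b n) x)
  simp only [anchoredSum]
  rw [ENNReal.tsum_comm]
  refine tsum_congr fun A => ?_
  split_ifs
  · rw [ENNReal.tsum_mul_left]
  · simp

/-- The pairs of intersecting sets whose first member contains `x`: the second member is anchored at
one of the points of the first, which costs a factor `|A₁|`, absorbed by the larger base `L`. -/
theorem tsum_anchored_pairs_le {l L t : ℝ≥0∞} (hlL : l ≤ L) (hk : ∀ k : ℕ, k * l ^ k ≤ t * L ^ k)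
    (a b : Finset (Site d) → ℝ≥0∞) (x : Site d) :
    ∑' A₁ : Finset (Site d), ∑' A₂ : Finset (Site d), (if x ∈ A₁ then
      ∑ y ∈ A₁, if y ∈ A₂ then (l ^ A₁.card * a A₁) * (l ^ A₂.card * b A₂) else 0 else 0) ≤
      t * (anchoredSup L a * anchoredSup L b) := by
  have h1 : ∀ A₁ : Finset (Site d), ∑' A₂ : Finset (Site d), (if x ∈ A₁ then
      ∑ y ∈ A₁, if y ∈ A₂ then (l ^ A₁.card * a A₁) * (l ^ A₂.card * b A₂) else 0 else 0) ≤
      (if x ∈ A₁ then L ^ A₁.card * a A₁ else 0) * (t * anchoredSup L b) := by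
    intro A₁
    split_ifs with hx
    · calc _ = ∑ y ∈ A₁, (l ^ A₁.card * a A₁) * anchoredSum l b y := by
            rw [Summable.tsum_finsetSum fun _ _ => ENNReal.summable]
            refine Finset.sum_congr rfl fun y _ => ?_
            rw [anchoredSum, ← ENNReal.tsum_mul_left]
            refine tsum_congr fun A₂ => ?_
            split_ifs <;> simp
        _ ≤ ∑ y ∈ A₁, (l ^ A₁.card * a A₁) * anchoredSup L b := by
            gcongr
            exact (anchoredSum_le l b _).trans (anchoredSup_mono hlL fun _ => le_rfl)
        _ = (A₁.card * l ^ A₁.card) * a A₁ * anchoredSup L b := by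
            rw [Finset.sum_const, nsmul_eq_mul]
            ring
        _ ≤ (t * L ^ A₁.card) * a A₁ * anchoredSup L b := by
            exact mul_le_mul_left (mul_le_mul_left (hk _) _) _
        _ = _ := by ring
    · simp
  calc _ ≤ ∑' A₁ : Finset (Site d),
        (if x ∈ A₁ then L ^ A₁.card * a A₁ else 0) * (t * anchoredSup L b) :=
        ENNReal.tsum_le_tsum h1
    _ = anchoredSum L a x * (t * anchoredSup L b) := by rw [ENNReal.tsum_mul_right]; rfl
    _ ≤ anchoredSup L a * (t * anchoredSup L b) := by
        gcongr
        exact anchoredSum_le L a x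
    _ = _ := by ring

theorem anchoredSup_unionConv_le {l L t : ℝ≥0∞} (hl : 1 ≤ l) (hlL : l ≤ L)
    (hk : ∀ k : ℕ, k * l ^ k ≤ t * L ^ k) (a b : Finset (Site d) → ℝ≥0∞) :
    anchoredSup l (unionConv a b) ≤ 2 * t * (anchoredSup L a * anchoredSup L b) := by
  refine iSup_le fun x => ?_
  have h1 : anchoredSum l (unionConv a b) x = ∑' A₁ : Finset (Site d), ∑' A₂ : Finset (Site d),
      if x ∈ A₁ ∪ A₂ ∧ ¬ Disjoint A₁ A₂ then l ^ (A₁ ∪ A₂).card * (a A₁ * b A₂) else 0 := by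
    have h2 : ∀ A : Finset (Site d), (if x ∈ A then l ^ A.card * unionConv a b A else 0) =
        ∑' A₁ : Finset (Site d), ∑' A₂ : Finset (Site d), if A = A₁ ∪ A₂ then
          (if x ∈ A₁ ∪ A₂ ∧ ¬ Disjoint A₁ A₂ then l ^ (A₁ ∪ A₂).card * (a A₁ * b A₂) else 0)
          else 0 := by
      intro A
      have h3 : (if x ∈ A then l ^ A.card * unionConv a b A else 0) =
          (if x ∈ A then l ^ A.card else 0) * unionConv a b A := by split_ifs <;> simp
      rw [h3, unionConv, ← ENNReal.tsum_mul_left]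
      refine tsum_congr fun A₁ => ?_
      rw [← ENNReal.tsum_mul_left]
      refine tsum_congr fun A₂ => ?_
      by_cases hA : A = A₁ ∪ A₂
      · subst hA
        by_cases hx : x ∈ A₁ ∪ A₂ <;> by_cases hd : Disjoint A₁ A₂ <;> simp [hx, hd]
      · rw [if_neg hA, if_neg (c := A₁ ∪ A₂ = A ∧ _) (fun h => hA h.1.symm), mul_zero]
    rw [anchoredSum]
    simp only [h2]
    rw [ENNReal.tsum_comm]
    refine tsum_congr fun A₁ => ?_
    rw [ENNReal.tsum_comm]
    exact tsum_congr fun A₂ => tsum_ite_eq _ _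
  have h4 : ∀ A₁ A₂ : Finset (Site d),
      (if x ∈ A₁ ∪ A₂ ∧ ¬ Disjoint A₁ A₂ then l ^ (A₁ ∪ A₂).card * (a A₁ * b A₂) else 0) ≤
      (if x ∈ A₁ then
        ∑ y ∈ A₁, if y ∈ A₂ then (l ^ A₁.card * a A₁) * (l ^ A₂.card * b A₂) else 0 else 0) +
      (if x ∈ A₂ then
        ∑ y ∈ A₂, if y ∈ A₁ then (l ^ A₂.card * b A₂) * (l ^ A₁.card * a A₁) else 0 else 0) := by
    intro A₁ A₂
    have hle : l ^ (A₁ ∪ A₂).card * (a A₁ * b A₂) ≤ l ^ (A₁.card + A₂.card) * (a A₁ * b A₂) :=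
      mul_le_mul_left (pow_le_pow_right₀ hl (Finset.card_union_le _ _)) _
    split_ifs with h hx₁ hx₂ hx₂
    all_goals try exact zero_le
    · obtain ⟨y, hy1, hy2⟩ := Finset.not_disjoint_iff.1 h.2
      refine le_add_right (le_trans ?_ (Finset.single_le_sum (fun _ _ => zero_le) hy1))
      rw [if_pos hy2]
      exact hle.trans_eq (by ring)
    · obtain ⟨y, hy1, hy2⟩ := Finset.not_disjoint_iff.1 h.2
      refine le_add_right (le_trans ?_ (Finset.single_le_sum (fun _ _ => zero_le) hy1))
      rw [if_pos hy2]
      exact hle.trans_eq (by ring)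
    · obtain ⟨y, hy1, hy2⟩ := Finset.not_disjoint_iff.1 h.2
      refine le_add_left (le_trans ?_ (Finset.single_le_sum (fun _ _ => zero_le) hy2))
      rw [if_pos hy1]
      exact hle.trans_eq (by ring)
    · exact ((Finset.mem_union.1 h.1).elim hx₁ hx₂).elim
  rw [h1]
  refine (ENNReal.tsum_le_tsum fun A₁ => ENNReal.tsum_le_tsum fun A₂ => h4 A₁ A₂).trans ?_
  simp only [ENNReal.tsum_add]
  rw [mul_assoc, two_mul]
  refine add_le_add (tsum_anchored_pairs_le hlL hk a b x) ?_
  rw [ENNReal.tsum_comm, mul_comm (anchoredSup L a)]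
  exact tsum_anchored_pairs_le hlL hk b a x

end Anchored

/-! ### Norms of potentials -/

section PotW

variable {κ : ℝ}

/-- The norm `sup_x ∑_{A ∋ x} l^|A| ‖𝒜(A)‖_κ`, in which the weight `l` of the volume is decoupled
from the parameter `κ` of the weighted operator norm. -/
def potW (κ l : ℝ) (𝒜 : Potential d) : ℝ≥0∞ :=
  anchoredSup (ENNReal.ofReal l) fun A => opNormW κ (𝒜 A)

theorem potNorm_eq_potW (κ : ℝ) (𝒜 : Potential d) : potNorm κ 𝒜 = potW κ κ 𝒜 := by
  refine iSup_congr fun x => ?_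
  rw [anchoredSum]
  refine (tsum_subtype {A : Finset (Site d) | x ∈ A}
    (fun A => ENNReal.ofReal κ ^ A.card * opNormW κ (𝒜 A))).trans (tsum_congr fun A => ?_)
  simp only [Set.indicator_apply, Set.mem_ofPred_eq]

theorem potW_mono_right {l l' : ℝ} (h : l ≤ l') (𝒜 : Potential d) : potW κ l 𝒜 ≤ potW κ l' 𝒜 :=
  anchoredSup_mono (ENNReal.ofReal_le_ofReal h) fun _ => le_rfl

theorem potW_add_le (hκ : 0 < κ) (l : ℝ) (𝒜 ℬ : Potential d) :
    potW κ l (𝒜 + ℬ) ≤ potW κ l 𝒜 + potW κ l ℬ :=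
  (anchoredSup_mono le_rfl fun A => opNormW_add_le hκ (𝒜 A) (ℬ A)).trans (anchoredSup_add_le _ _ _)

theorem potW_sub_le (hκ : 0 < κ) (l : ℝ) (𝒜 ℬ : Potential d) :
    potW κ l (𝒜 - ℬ) ≤ potW κ l 𝒜 + potW κ l ℬ :=
  (anchoredSup_mono le_rfl fun A => opNormW_sub_le hκ (𝒜 A) (ℬ A)).trans (anchoredSup_add_le _ _ _)

theorem potW_neg (hκ : 0 < κ) (l : ℝ) (𝒜 : Potential d) : potW κ l (-𝒜) = potW κ l 𝒜 := by
  simp only [potW, Pi.neg_apply, opNormW_neg hκ]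

theorem potW_le_of_mel_le (hκ : 0 < κ) (l : ℝ) {c : ℝ≥0∞} {𝒜 ℬ : Potential d}
    (h : ∀ A (η η' : Conf A), ‖mel (𝒜 A) η η'‖ₑ ≤ c * ‖mel (ℬ A) η η'‖ₑ) :
    potW κ l 𝒜 ≤ c * potW κ l ℬ := by
  rw [potW, potW, ← anchoredSup_mul_left]
  exact anchoredSup_mono le_rfl fun A => opNormW_le_of_enorm_mel_le hκ (h A)

theorem potW_smul_le (hκ : 0 < κ) (l : ℝ) (c : ℂ) (𝒜 : Potential d) :
    potW κ l (c • 𝒜) ≤ ‖c‖ₑ * potW κ l 𝒜 :=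
  potW_le_of_mel_le hκ l fun A η η' => by rw [Pi.smul_apply, mel_smul, enorm_mul]

theorem potW_le_tsum (hκ : 0 < κ) (l : ℝ) {𝒜 : ℕ → Potential d} {ℬ : Potential d}
    (h : ∀ A, HasSum (fun n => 𝒜 n A) (ℬ A)) : potW κ l ℬ ≤ ∑' n, potW κ l (𝒜 n) :=
  (anchoredSup_mono le_rfl fun A => opNormW_le_tsum hκ (h A)).trans (anchoredSup_tsum_le _ _)

theorem opNormW_le_potW {l : ℝ} (hl : 1 ≤ l) (𝒜 : Potential d) {A : Finset (Site d)}
    (hA : A.Nonempty) : opNormW κ (𝒜 A) ≤ potW κ l 𝒜 := by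
  obtain ⟨x, hx⟩ := hA
  refine le_trans ?_ (anchoredSum_le _ _ x)
  refine le_trans ?_ (ENNReal.le_tsum A)
  rw [if_pos hx]
  refine le_mul_of_one_le_left' (one_le_pow₀ ?_)
  exact ENNReal.one_le_ofReal.2 hl

end PotW

/-! ### Commutators of potentials -/

section Ad

variable {κ : ℝ}

theorem ad_add (𝒜 ℬ ℬ' : Potential d) : ad 𝒜 (ℬ + ℬ') = ad 𝒜 ℬ + ad 𝒜 ℬ' := by
  funext A
  simp only [ad, Pi.add_apply, ← Finset.sum_add_distrib]
  refine Finset.sum_congr rfl fun A₁ _ => Finset.sum_congr rfl fun A₂ _ => ?_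
  split_ifs
  · rw [extend_add, Ring.lie_def, Ring.lie_def, Ring.lie_def, mul_add, add_mul]
    abel
  · simp

theorem ad_smul (𝒜 : Potential d) (c : ℂ) (ℬ : Potential d) : ad 𝒜 (c • ℬ) = c • ad 𝒜 ℬ := by
  funext A
  simp only [ad, Pi.smul_apply, Finset.smul_sum]
  refine Finset.sum_congr rfl fun A₁ _ => Finset.sum_congr rfl fun A₂ _ => ?_
  split_ifs
  · rw [extend_smul, Ring.lie_def, Ring.lie_def, mul_smul_comm, smul_mul_assoc, smul_sub]
  · simp

/-- `ad_𝒜` as a linear map. -/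
def adL (𝒜 : Potential d) : Potential d →ₗ[ℂ] Potential d where
  toFun := ad 𝒜
  map_add' := ad_add 𝒜
  map_smul' := ad_smul 𝒜

theorem iterate_ad_eq (𝒜 : Potential d) (n : ℕ) : (ad 𝒜)^[n] = ⇑((adL 𝒜) ^ n) := by
  rw [Module.End.coe_pow]
  rfl

theorem expTerm_eq (𝒜 ℬ : Potential d) (n : ℕ) :
    expTerm 𝒜 ℬ n = ((n.factorial : ℂ)⁻¹) • ((adL 𝒜) ^ n) ℬ := by
  rw [expTerm, iterate_ad_eq]

theorem lie_extend_of_disjoint {A A₁ A₂ : Finset (Site d)} (h₁ : A₁ ⊆ A) (h₂ : A₂ ⊆ A)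
    (hd : Disjoint A₁ A₂) (O₁ : Op A₁) (O₂ : Op A₂) : ⁅extend h₁ O₁, extend h₂ O₂⁆ = 0 := by
  rw [Ring.lie_def, commute_extend h₁ h₂ hd, sub_self]

theorem opNormW_ad_le (hκ : 0 < κ) (𝒜 ℬ : Potential d) (A : Finset (Site d)) :
    opNormW κ (ad 𝒜 ℬ A) ≤
      2 * unionConv (fun A => opNormW κ (𝒜 A)) (fun A => opNormW κ (ℬ A)) A := by
  classical
  have h1 : ∀ A₁ A₂ : A.powerset, opNormW κ (if A₁.1 ∪ A₂.1 = A then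
      ⁅extend (Finset.mem_powerset.1 A₁.2) (𝒜 A₁.1), extend (Finset.mem_powerset.1 A₂.2) (ℬ A₂.1)⁆
      else 0) ≤ 2 * if A₁.1 ∪ A₂.1 = A ∧ ¬ Disjoint A₁.1 A₂.1 then
        opNormW κ (𝒜 A₁.1) * opNormW κ (ℬ A₂.1) else 0 := by
    intro A₁ A₂
    by_cases hA : A₁.1 ∪ A₂.1 = A
    · rw [if_pos hA]
      by_cases hd : Disjoint A₁.1 A₂.1
      · rw [lie_extend_of_disjoint _ _ hd, opNormW_zero hκ]
        exact zero_le
      · rw [if_pos ⟨hA, hd⟩]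
        refine (opNormW_commutator_le hκ _ _).trans ?_
        gcongr <;> exact opNormW_extend_le hκ _ _
    · rw [if_neg hA, opNormW_zero hκ]
      exact zero_le
  calc opNormW κ (ad 𝒜 ℬ A)
      ≤ ∑ A₁ : A.powerset, ∑ A₂ : A.powerset, 2 * if A₁.1 ∪ A₂.1 = A ∧ ¬ Disjoint A₁.1 A₂.1 then
        opNormW κ (𝒜 A₁.1) * opNormW κ (ℬ A₂.1) else 0 := by
        refine (opNormW_sum_le hκ _ _).trans (Finset.sum_le_sum fun A₁ _ => ?_)
        refine (opNormW_sum_le hκ _ _).trans (Finset.sum_le_sum fun A₂ _ => ?_)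
        convert h1 A₁ A₂
    _ = 2 * ∑ A₁ ∈ A.powerset, ∑ A₂ ∈ A.powerset, if A₁ ∪ A₂ = A ∧ ¬ Disjoint A₁ A₂ then
        opNormW κ (𝒜 A₁) * opNormW κ (ℬ A₂) else 0 := by
        simp only [← Finset.mul_sum]
        congr 1
        rw [← Finset.sum_coe_sort A.powerset]
        refine Finset.sum_congr rfl fun A₁ _ => ?_
        rw [← Finset.sum_coe_sort A.powerset]
    _ ≤ _ := by
        gcongr
        refine le_trans ?_ (ENNReal.sum_le_tsum A.powerset)
        gcongr
        exact ENNReal.sum_le_tsum A.powerset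

theorem mul_ofReal_pow_le {l θ : ℝ} (hl : 0 ≤ l) (hθ : 0 < θ) (k : ℕ) :
    (k : ℝ≥0∞) * ENNReal.ofReal l ^ k ≤
      ENNReal.ofReal (1 / θ) * ENNReal.ofReal (l * Real.exp θ) ^ k := by
  rw [← ENNReal.ofReal_natCast, ← ENNReal.ofReal_pow hl, ← ENNReal.ofReal_pow (by positivity),
    ← ENNReal.ofReal_mul (by positivity), ← ENNReal.ofReal_mul (by positivity)]
  refine ENNReal.ofReal_le_ofReal ?_
  have h : k * θ ≤ Real.exp θ ^ k := by
    rw [← Real.exp_nat_mul]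
    linarith [Real.add_one_le_exp (k * θ)]
  rw [mul_pow, one_div, inv_mul_eq_div, le_div_iff₀ hθ]
  calc (k : ℝ) * l ^ k * θ = l ^ k * (k * θ) := by ring
    _ ≤ l ^ k * Real.exp θ ^ k := by gcongr

theorem potW_ad_le (hκ : 0 < κ) {l θ : ℝ} (hl : 1 ≤ l) (hθ : 0 < θ) (𝒜 ℬ : Potential d) :
    potW κ l (ad 𝒜 ℬ) ≤
      ENNReal.ofReal (4 / θ) * (potW κ (l * Real.exp θ) 𝒜 * potW κ (l * Real.exp θ) ℬ) := by
  have hlL : l ≤ l * Real.exp θ :=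
    le_mul_of_one_le_right (by linarith) (Real.one_le_exp hθ.le)
  have h4 : ENNReal.ofReal (4 / θ) = 2 * (2 * ENNReal.ofReal (1 / θ)) := by
    rw [← mul_assoc, show (2 : ℝ≥0∞) * 2 = ENNReal.ofReal 4 by norm_num,
      ← ENNReal.ofReal_mul (by norm_num)]
    congr 1
    ring
  calc potW κ l (ad 𝒜 ℬ) ≤ 2 * anchoredSup (ENNReal.ofReal l)
        (unionConv (fun A => opNormW κ (𝒜 A)) (fun A => opNormW κ (ℬ A))) := by
        rw [← anchoredSup_mul_left]
        exact anchoredSup_mono le_rfl fun A => opNormW_ad_le hκ 𝒜 ℬ A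
    _ ≤ 2 * (2 * ENNReal.ofReal (1 / θ) *
        (potW κ (l * Real.exp θ) 𝒜 * potW κ (l * Real.exp θ) ℬ)) := by
        gcongr
        exact anchoredSup_unionConv_le (ENNReal.one_le_ofReal.2 hl) (ENNReal.ofReal_le_ofReal hlL)
          (fun k => mul_ofReal_pow_le (by linarith) hθ k) _ _
    _ = _ := by rw [h4]; ring

theorem potW_iterate_ad_le (hκ : 0 < κ) {l ε : ℝ} (hl : 1 ≤ l) (hε : 0 < ε) (𝒜 ℬ : Potential d)
    (n : ℕ) : potW κ l ((ad 𝒜)^[n] ℬ) ≤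
      (ENNReal.ofReal (4 / ε) * potW κ (l * Real.exp (n * ε)) 𝒜) ^ n *
        potW κ (l * Real.exp (n * ε)) ℬ := by
  induction n generalizing l with
  | zero => simp
  | succ n ih =>
    have h1 : (1 : ℝ) ≤ Real.exp ε := Real.one_le_exp hε.le
    have hl' : 1 ≤ l * Real.exp ε := one_le_mul_of_one_le_of_one_le hl h1
    have he : l * Real.exp ε * Real.exp (n * ε) = l * Real.exp ((n + 1 : ℕ) * ε) := by
      rw [mul_assoc, ← Real.exp_add]
      congr 2
      push_cast
      ring
    have h2 := ih hl'
    rw [he] at h2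
    rw [Function.iterate_succ_apply']
    refine (potW_ad_le hκ hl hε _ _).trans ?_
    calc _ ≤ ENNReal.ofReal (4 / ε) * (potW κ (l * Real.exp ((n + 1 : ℕ) * ε)) 𝒜 *
          ((ENNReal.ofReal (4 / ε) * potW κ (l * Real.exp ((n + 1 : ℕ) * ε)) 𝒜) ^ n *
            potW κ (l * Real.exp ((n + 1 : ℕ) * ε)) ℬ)) := by
          gcongr
          refine potW_mono_right ?_ _
          rw [← he]
          exact le_mul_of_one_le_right (by linarith) (Real.one_le_exp (by positivity))
      _ = _ := by ring

/-- The loss of volume weight is divided evenly among the `n` commutators; the resulting factor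
`n^n` is compensated by the factorial. -/
theorem potW_expTerm_le (hκ : 0 < κ) {l θ : ℝ} (hl : 1 ≤ l) (hθ : 0 < θ) (𝒜 ℬ : Potential d)
    (n : ℕ) : potW κ l (expTerm 𝒜 ℬ n) ≤
      (ENNReal.ofReal (12 / θ) * potW κ (l * Real.exp θ) 𝒜) ^ n * potW κ (l * Real.exp θ) ℬ := by
  rcases Nat.eq_zero_or_pos n with rfl | hn
  · simp only [expTerm, Nat.factorial_zero, Nat.cast_one, inv_one, Function.iterate_zero, id,
      one_smul, pow_zero, one_mul]
    exact potW_mono_right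
      (le_mul_of_one_le_right (by linarith) (Real.one_le_exp hθ.le)) _
  · have hn' : (0 : ℝ) < n := Nat.cast_pos.2 hn
    have h1 := potW_iterate_ad_le hκ hl (div_pos hθ hn') 𝒜 ℬ n
    rw [mul_div_cancel₀ _ hn'.ne'] at h1
    refine (potW_smul_le hκ l _ _).trans ?_
    calc _ ≤ ‖((n.factorial : ℂ)⁻¹)‖ₑ * ((ENNReal.ofReal (4 / (θ / n)) *
          potW κ (l * Real.exp θ) 𝒜) ^ n * potW κ (l * Real.exp θ) ℬ) := by gcongr
      _ = (‖((n.factorial : ℂ)⁻¹)‖ₑ * ENNReal.ofReal (4 / (θ / n)) ^ n) *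
          (potW κ (l * Real.exp θ) 𝒜 ^ n * potW κ (l * Real.exp θ) ℬ) := by ring
      _ ≤ ENNReal.ofReal (12 / θ) ^ n *
          (potW κ (l * Real.exp θ) 𝒜 ^ n * potW κ (l * Real.exp θ) ℬ) := by
          gcongr
          rw [← ofReal_norm, ← ENNReal.ofReal_pow (by positivity),
            ← ENNReal.ofReal_pow (by positivity), ← ENNReal.ofReal_mul (by positivity)]
          refine ENNReal.ofReal_le_ofReal ?_
          have h2 : (n : ℝ) ^ n / n.factorial ≤ 3 ^ n := by
            refine (Real.pow_div_factorial_le_exp _ hn'.le n).trans ?_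
            rw [← Real.exp_one_pow]
            gcongr
            linarith [Real.exp_one_lt_d9]
          have h3 : ‖((n.factorial : ℂ)⁻¹)‖ = (n.factorial : ℝ)⁻¹ := by simp
          rw [h3]
          calc (n.factorial : ℝ)⁻¹ * (4 / (θ / n)) ^ n
              = (4 / θ) ^ n * ((n : ℝ) ^ n / n.factorial) := by
                rw [div_div_eq_mul_div, mul_div_right_comm, mul_pow]
                ring
            _ ≤ (4 / θ) ^ n * 3 ^ n := by gcongr
            _ = (12 / θ) ^ n := by
                rw [← mul_pow]
                congr 1
                ring
      _ = _ := by ring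

end Ad

/-! ### Connectedness, support in `Λ`, and the cutoff -/

section Admissible

variable {M : ℝ} {Λ : Finset (Site d)}

/-- Interaction potentials that are supported in the volume `Λ` and whose matrix elements vanish
above the cutoff `M`. -/
structure Admissible (M : ℝ) (Λ : Finset (Site d)) (𝒜 : Potential d) : Prop where
  interaction : IsInteraction 𝒜
  support : ∀ A, ¬ A ⊆ Λ → 𝒜 A = 0
  cut : ∀ A (η η' : Conf A), mel (𝒜 A) η η' ≠ 0 → η ∈ cutConf M A ∧ η' ∈ cutConf M A

theorem mem_cutConf {A : Finset (Site d)} {η : Conf A} :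
    η ∈ cutConf M A ↔ ∀ x, η x < ⌊M⌋₊ + 1 := by
  simp [cutConf]

theorem Admissible.cutPotential_eq {𝒜 : Potential d} (h : Admissible M Λ 𝒜) :
    cutPotential M 𝒜 = 𝒜 := by
  funext A
  refine op_ext fun η η' => ?_
  rw [cutPotential, mel_cutOp]
  split_ifs with hc
  · rfl
  · by_contra hne
    exact hc (h.cut A η η' (Ne.symm hne))

/-- Admissibility only depends on which matrix elements vanish. -/
theorem Admissible.of_mel {𝒜 ℬ : Potential d} (h : Admissible M Λ 𝒜)
    (hm : ∀ A (η η' : Conf A), mel (ℬ A) η η' ≠ 0 → mel (𝒜 A) η η' ≠ 0) : Admissible M Λ ℬ := by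
  have h0 : ∀ A, 𝒜 A = 0 → ℬ A = 0 := fun A hA => op_ext fun η η' => by
    by_contra hne
    rw [mel_zero] at hne
    exact hm A η η' hne (by rw [hA, mel_zero])
  exact ⟨fun A hA => h0 A (h.interaction A hA), fun A hA => h0 A (h.support A hA),
    fun A η η' hne => h.cut A η η' (hm A η η' hne)⟩

theorem Admissible.add {𝒜 ℬ : Potential d} (h : Admissible M Λ 𝒜) (h' : Admissible M Λ ℬ) :
    Admissible M Λ (𝒜 + ℬ) := by
  refine ⟨fun A hA => ?_, fun A hA => ?_, fun A η η' hne => ?_⟩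
  · rw [Pi.add_apply, h.interaction A hA, h'.interaction A hA, add_zero]
  · rw [Pi.add_apply, h.support A hA, h'.support A hA, add_zero]
  · rw [Pi.add_apply, mel_add] at hne
    by_cases h0 : mel (𝒜 A) η η' = 0
    · exact h'.cut A η η' (by simpa [h0] using hne)
    · exact h.cut A η η' h0

theorem Admissible.smul {𝒜 : Potential d} (h : Admissible M Λ 𝒜) (c : ℂ) :
    Admissible M Λ (c • 𝒜) :=
  h.of_mel fun A η η' hne => by
    rw [Pi.smul_apply, mel_smul] at hne
    exact right_ne_zero_of_mul hne

theorem Admissible.sub {𝒜 ℬ : Potential d} (h : Admissible M Λ 𝒜) (h' : Admissible M Λ ℬ) :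
    Admissible M Λ (𝒜 - ℬ) := by
  have := h.add (h'.smul (-1))
  rwa [neg_one_smul, ← sub_eq_add_neg] at this

theorem Admissible.tsum {𝒜 : ℕ → Potential d} (h : ∀ n, Admissible M Λ (𝒜 n)) :
    Admissible M Λ (fun A => ∑' n, 𝒜 n A) := by
  refine ⟨fun A hA => ?_, fun A hA => ?_, fun A η η' hne => ?_⟩
  · simp [fun n => (h n).interaction A hA]
  · simp [fun n => (h n).support A hA]
  · by_contra hc
    apply hne
    by_cases hs : Summable fun n => 𝒜 n A
    · rw [← (hasSum_mel hs.hasSum η η').tsum_eq, ← tsum_zero]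
      refine tsum_congr fun n => ?_
      by_contra h0
      exact hc ((h n).cut A η η' h0)
    · rw [tsum_eq_zero_of_not_summable hs, mel_zero]

theorem isConn_union {A₁ A₂ : Finset (Site d)} (h₁ : IsConn A₁) (h₂ : IsConn A₂)
    (hd : ¬ Disjoint A₁ A₂) : IsConn (A₁ ∪ A₂) := by
  rw [IsConn, Finset.coe_union]
  refine SimpleGraph.induce_union_connected h₁.preconnected h₂.preconnected ?_
  obtain ⟨y, hy1, hy2⟩ := Finset.not_disjoint_iff.1 hd
  exact ⟨y, hy1, hy2⟩

/-- Outside of its own volume, the cutoff of a product is provided by the other factor. -/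
theorem mem_cutConf_of_mel_extend_mul_ne_zero {A A₁ A₂ : Finset (Site d)} (h₁ : A₁ ⊆ A)
    (h₂ : A₂ ⊆ A) (hA : A₁ ∪ A₂ = A) {O₁ : Op A₁} {O₂ : Op A₂}
    (c₁ : ∀ η η', mel O₁ η η' ≠ 0 → η ∈ cutConf M A₁ ∧ η' ∈ cutConf M A₁)
    (c₂ : ∀ η η', mel O₂ η η' ≠ 0 → η ∈ cutConf M A₂ ∧ η' ∈ cutConf M A₂) {η η' : Conf A}
    (hne : mel (extend h₁ O₁ * extend h₂ O₂) η η' ≠ 0) :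
    η ∈ cutConf M A ∧ η' ∈ cutConf M A := by
  obtain ⟨ζ, hz1, hz2⟩ := exists_of_mel_mul_ne_zero hne
  obtain ⟨a1, b1⟩ := mel_extend_ne_zero hz1
  obtain ⟨a2, b2⟩ := mel_extend_ne_zero hz2
  obtain ⟨p1, p1'⟩ := c₁ _ _ b1
  obtain ⟨p2, p2'⟩ := c₂ _ _ b2
  rw [mem_cutConf] at *
  have hmem : ∀ x : A, x.1 ∈ A₁ ∨ x.1 ∈ A₂ := fun x =>
    Finset.mem_union.1 (hA.symm ▸ x.2 : x.1 ∈ A₁ ∪ A₂)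
  constructor
  · intro x
    by_cases hx : x.1 ∈ A₁
    · exact p1 ⟨x.1, hx⟩
    · rw [a1 x hx]
      exact p2 ⟨x.1, (hmem x).resolve_left hx⟩
  · rw [mem_cutConf]
    intro x
    by_cases hx : x.1 ∈ A₂
    · exact p2' ⟨x.1, hx⟩
    · rw [← a2 x hx]
      exact p1' ⟨x.1, (hmem x).resolve_right hx⟩

theorem Admissible.ad {𝒜 ℬ : Potential d} (h : Admissible M Λ 𝒜) (h' : Admissible M Λ ℬ) :
    Admissible M Λ (ad 𝒜 ℬ) := by
  classical
  have h0 : ∀ A : Finset (Site d), (∀ (A₁ A₂ : A.powerset), A₁.1 ∪ A₂.1 = A →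
      𝒜 A₁.1 = 0 ∨ ℬ A₂.1 = 0 ∨ Disjoint A₁.1 A₂.1) → MBL.ad 𝒜 ℬ A = 0 := by
    intro A hA
    refine Finset.sum_eq_zero fun A₁ _ => Finset.sum_eq_zero fun A₂ _ => ?_
    split_ifs with hU
    · rcases hA A₁ A₂ hU with h | h | h
      · simp [h, Ring.lie_def]
      · simp [h, Ring.lie_def]
      · exact lie_extend_of_disjoint _ _ h _ _
    · rfl
  refine ⟨fun A hA => h0 A fun A₁ A₂ hU => ?_, fun A hA => h0 A fun A₁ A₂ hU => ?_,
    fun A η η' hne => ?_⟩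
  · by_contra! hc
    refine hA (hU ▸ isConn_union ?_ ?_ hc.2.2)
    · by_contra h1
      exact hc.1 (h.interaction _ h1)
    · by_contra h1
      exact hc.2.1 (h'.interaction _ h1)
  · by_contra! hc
    refine hA (hU ▸ Finset.union_subset ?_ ?_)
    · by_contra h1
      exact hc.1 (h.support _ h1)
    · by_contra h1
      exact hc.2.1 (h'.support _ h1)
  · rw [MBL.ad, mel_sum] at hne
    obtain ⟨A₁, -, hne⟩ := Finset.exists_ne_zero_of_sum_ne_zero hne
    rw [mel_sum] at hne
    obtain ⟨A₂, -, hne⟩ := Finset.exists_ne_zero_of_sum_ne_zero hne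
    split_ifs at hne with hU
    · rw [Ring.lie_def, mel_sub] at hne
      by_cases hz : mel (extend (Finset.mem_powerset.1 A₁.2) (𝒜 A₁.1) *
          extend (Finset.mem_powerset.1 A₂.2) (ℬ A₂.1)) η η' = 0
      · rw [hz, zero_sub, neg_ne_zero] at hne
        exact mem_cutConf_of_mel_extend_mul_ne_zero _ _ (by rwa [Finset.union_comm])
          (h'.cut _) (h.cut _) hne
      · exact mem_cutConf_of_mel_extend_mul_ne_zero _ _ hU (h.cut _) (h'.cut _) hz
    · simp at hne

theorem Admissible.expTerm {𝒜 ℬ : Potential d} (h : Admissible M Λ 𝒜) (h' : Admissible M Λ ℬ)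
    (n : ℕ) : Admissible M Λ (expTerm 𝒜 ℬ n) := by
  refine Admissible.smul ?_ _
  induction n with
  | zero => exact h'
  | succ n ih =>
    rw [Function.iterate_succ_apply']
    exact h.ad ih

theorem Admissible.expAd {𝒜 ℬ : Potential d} (h : Admissible M Λ 𝒜) (h' : Admissible M Λ ℬ) :
    Admissible M Λ (expAd 𝒜 ℬ) :=
  Admissible.tsum fun n => h.expTerm h' n

end Admissible

/-! ### The local interaction -/

section Ladder

variable {A : Finset (Site d)} {κ M : ℝ}

/-- Operators which, like the creation operator (`s = 1`) and the annihilation operator (`s = -1`),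
map each basis vector `η'` to a multiple `c` of a basis vector `η`, where `η` is obtained from `η'`
by adding `s` at the site `x` unless `c = 0`, and `|c|² ≤ η'(x) + 1`. -/
def IsLadder (T : CoreOp A) (x : A) (s : ℤ) : Prop :=
  ∀ η' : Conf A, ∃ (η : Conf A) (c : ℂ), T (Finsupp.single η' 1) = Finsupp.single η c ∧
    (c ≠ 0 → ∀ y, (η y : ℤ) = η' y + if y = x then s else 0) ∧
    ‖c‖ ^ 2 ≤ η' x + 1 ∧ ∀ y, η y ≤ η' y + 1

theorem isLadder_cre (x : A) : IsLadder (cre x) x 1 := by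
  intro η'
  refine ⟨Function.update η' x (η' x + 1), ((Real.sqrt (η' x + 1) : ℝ) : ℂ), by simp [cre],
    ?_, ?_, ?_⟩
  · intro _ y
    by_cases hy : y = x
    · subst hy
      simp
    · simp [hy]
  · rw [Complex.norm_real, Real.norm_eq_abs, sq_abs, Real.sq_sqrt (by positivity)]
  · intro y
    by_cases hy : y = x
    · subst hy
      simp
    · simp [hy]

theorem isLadder_ann (x : A) : IsLadder (ann x) x (-1) := by
  intro η'
  refine ⟨Function.update η' x (η' x - 1), ((Real.sqrt (η' x) : ℝ) : ℂ), by simp [ann], ?_, ?_, ?_⟩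
  · intro hc y
    by_cases hy : y = x
    · subst hy
      have : η' y ≠ 0 := fun h => hc (by simp [h])
      simp only [Function.update_self, if_true]
      omega
    · simp [hy]
  · rw [Complex.norm_real, Real.norm_eq_abs, sq_abs, Real.sq_sqrt (by positivity)]
    linarith
  · intro y
    by_cases hy : y = x
    · subst hy
      simp only [Function.update_self]
      omega
    · simp [hy]

theorem weight_div_weight (hκ : 0 < κ) {w : A → ℝ} (hw : ∀ x, κ⁻¹ ≤ w x ∧ w x ≤ κ) {η η' : Conf A}
    {x₁ x₂ : A} {s₁ s₂ : ℤ} (h : ∀ y, (η y : ℤ) = η' y + (if y = x₁ then s₁ else 0) +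
      if y = x₂ then s₂ else 0) :
    weight w η * (weight w η')⁻¹ = w x₁ ^ s₁ * w x₂ ^ s₂ := by
  classical
  have hpos : ∀ y, w y ≠ 0 := fun y => ((inv_pos.2 hκ).trans_le (hw y).1).ne'
  have h1 : ∀ (x : A) (s : ℤ), ∏ y, w y ^ (if y = x then s else 0) = w x ^ s := by
    intro x s
    rw [Finset.prod_eq_single x]
    · simp
    · intro y _ hy
      simp [hy]
    · simp
  have h2 : weight w η = weight w η' * (w x₁ ^ s₁ * w x₂ ^ s₂) := by
    rw [weight, weight, ← h1 x₁ s₁, ← h1 x₂ s₂, ← Finset.prod_mul_distrib,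
      ← Finset.prod_mul_distrib]
    refine Finset.prod_congr rfl fun y _ => ?_
    rw [← zpow_natCast, h y, zpow_add₀ (hpos y), zpow_add₀ (hpos y), zpow_natCast, mul_assoc]
  rw [h2, mul_comm, ← mul_assoc, inv_mul_cancel₀ (weight_pos hκ hw η').ne', one_mul]

/-- In the occupation basis, a product of two ladder operators has at most one nonzero entry in each
row and column, and conjugation by `w^N` multiplies each entry by at most `κ²`. -/
theorem opNormW_cutCore_ladder_mul_le (hκ : 1 ≤ κ) (hM : 1 ≤ M) {T₁ T₂ : CoreOp A} {x₁ x₂ : A}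
    {s₁ s₂ : ℤ} (h₁ : IsLadder T₁ x₁ s₁) (h₂ : IsLadder T₂ x₂ s₂) (hs₁ : s₁ = 1 ∨ s₁ = -1)
    (hs₂ : s₂ = 1 ∨ s₂ = -1) :
    opNormW κ (cutCore M (T₂ * T₁)) ≤ ENNReal.ofReal (3 * M * κ ^ 2) := by
  have hκ0 : 0 < κ := zero_lt_one.trans_le hκ
  have hmel : ∀ η η', mel (cutCore M (T₂ * T₁)) η η' ≠ 0 → (∀ y, (η y : ℤ) = η' y +
      (if y = x₁ then s₁ else 0) + if y = x₂ then s₂ else 0) ∧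
      ‖mel (cutCore M (T₂ * T₁)) η η'‖ ≤ 3 * M := by
    intro η η' hne
    rw [mel_cutCore] at hne ⊢
    by_cases hc : η ∈ cutConf M A ∧ η' ∈ cutConf M A
    swap
    · rw [if_neg hc] at hne
      exact (hne rfl).elim
    rw [if_pos hc] at hne ⊢
    obtain ⟨ζ, c₁, e1, f1, n1, m1⟩ := h₁ η'
    obtain ⟨ξ, c₂, e2, f2, n2, m2⟩ := h₂ ζ
    have e3 : (T₂ * T₁) (Finsupp.single η' 1) = Finsupp.single ξ (c₁ * c₂) := by
      have h3 : Finsupp.single ζ c₁ = c₁ • Finsupp.single ζ (1 : ℂ) := by simp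
      rw [Module.End.mul_apply, e1, h3, map_smul, e2]
      simp
    rw [e3] at hne ⊢
    have hξ : ξ = η := by
      by_contra hne'
      exact hne (Finsupp.single_eq_of_ne (Ne.symm hne'))
    subst hξ
    rw [Finsupp.single_eq_same] at hne ⊢
    refine ⟨fun y => by rw [f2 (right_ne_zero_of_mul hne), f1 (left_ne_zero_of_mul hne)], ?_⟩
    have hM' : ∀ y, (η' y : ℝ) ≤ M := fun y =>
      (Nat.cast_le.2 (Nat.lt_succ_iff.1 (mem_cutConf.1 hc.2 y))).trans (Nat.floor_le (by linarith))
    have a1 : ‖c₁‖ ^ 2 ≤ 3 * M := by linarith [hM' x₁]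
    have a2 : ‖c₂‖ ^ 2 ≤ 3 * M := by
      have : (ζ x₂ : ℝ) ≤ η' x₂ + 1 := by exact_mod_cast m1 x₂
      linarith [hM' x₂]
    rw [norm_mul]
    nlinarith [sq_nonneg (‖c₁‖ - ‖c₂‖)]
  refine opNormW_le fun w hw => ?_
  have hne : ∀ {η η'}, wKernel w (cutCore M (T₂ * T₁)) η η' ≠ 0 →
      mel (cutCore M (T₂ * T₁)) η η' ≠ 0 := by
    intro η η' h h0
    apply h
    rw [wKernel_eq hκ0 hw, h0, enorm_zero, mul_zero]
  refine kernelNorm_le_of_subsingleton (fun η η' => ?_) (fun η ξ ξ' h h' => ?_)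
    (fun η ξ ξ' h h' => ?_)
  · by_cases h0 : mel (cutCore M (T₂ * T₁)) η η' = 0
    · rw [wKernel_eq hκ0 hw, h0, enorm_zero, mul_zero]
      exact zero_le
    · obtain ⟨hsh, hb⟩ := hmel η η' h0
      have hz : ∀ (x : A) (s : ℤ), s = 1 ∨ s = -1 → 0 < w x ^ s ∧ w x ^ s ≤ κ := by
        intro x s hs
        have hx : 0 < w x := (inv_pos.2 hκ0).trans_le (hw x).1
        refine ⟨zpow_pos hx s, ?_⟩
        rcases hs with rfl | rfl
        · rw [zpow_one]
          exact (hw x).2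
        · rw [zpow_neg_one]
          exact inv_le_of_inv_le₀ hκ0 (hw x).1
      have z1 := hz x₁ s₁ hs₁
      have z2 := hz x₂ s₂ hs₂
      rw [wKernel_eq hκ0 hw, weight_div_weight hκ0 hw hsh, ← ofReal_norm,
        ← ENNReal.ofReal_mul (mul_pos z1.1 z2.1).le]
      refine ENNReal.ofReal_le_ofReal ?_
      calc _ ≤ (κ * κ) * (3 * M) := by
            gcongr
            · exact z2.1.le
            · exact z1.2
            · exact z2.2
        _ = _ := by ring
  · have a := (hmel _ _ (hne h)).1
    have a' := (hmel _ _ (hne h')).1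
    funext y
    have := a y
    have := a' y
    omega
  · have a := (hmel _ _ (hne h)).1
    have a' := (hmel _ _ (hne h')).1
    funext y
    have := a y
    have := a' y
    omega

theorem cutCore_add (M : ℝ) (S T : CoreOp A) : cutCore M (S + T) = cutCore M S + cutCore M T := by
  refine op_ext fun η η' => ?_
  simp only [mel_add, mel_cutCore]
  split_ifs <;> simp

theorem cutCore_smul (M : ℝ) (c : ℂ) (T : CoreOp A) : cutCore M (c • T) = c • cutCore M T := by
  refine op_ext fun η η' => ?_
  simp only [mel_smul, mel_cutCore]
  split_ifs <;> simp

/-- The cutoff of operators as a linear map. -/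
def cutCoreL (M : ℝ) (A : Finset (Site d)) : CoreOp A →ₗ[ℂ] Op A where
  toFun := cutCore M
  map_add' := cutCore_add M
  map_smul' := cutCore_smul M

theorem opNormW_cutCore_siteInteraction_le (hκ : 1 ≤ κ) (hM : 1 ≤ M) {g₁ g₂ : ℝ} (hg₁ : |g₁| ≤ 1)
    (hg₂ : |g₂| ≤ 1) (x : A) : opNormW κ (cutCore M (siteInteraction g₁ g₂ x)) ≤
      (4 + A.card) * ENNReal.ofReal (3 * M * κ ^ 2) := by
  classical
  have hκ0 : 0 < κ := zero_lt_one.trans_le hκ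
  set b := ENNReal.ofReal (3 * M * κ ^ 2)
  have hadd : ∀ S T : CoreOp A, opNormW κ (cutCore M (S + T)) ≤
      opNormW κ (cutCore M S) + opNormW κ (cutCore M T) := fun S T => by
    rw [cutCore_add]
    exact opNormW_add_le hκ0 _ _
  have hsmul : ∀ (g : ℝ) (T : CoreOp A), |g| ≤ 1 →
      opNormW κ (cutCore M ((g : ℂ) • T)) ≤ opNormW κ (cutCore M T) := fun g T hg => by
    rw [cutCore_smul]
    refine (opNormW_smul_le hκ0 _ _).trans (mul_le_of_le_one_left' ?_)
    rw [← ofReal_norm, Complex.norm_real, Real.norm_eq_abs]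
    exact ENNReal.ofReal_le_one.2 hg
  have h1 : opNormW κ (cutCore M ((ann x + cre x) ^ 2)) ≤ 4 * b := by
    have e : (ann x + cre x) ^ 2 =
        (ann x * ann x + ann x * cre x) + (cre x * ann x + cre x * cre x) := by
      rw [sq, add_mul, mul_add, mul_add]
    rw [e]
    refine (hadd _ _).trans ((add_le_add (hadd _ _) (hadd _ _)).trans ?_)
    calc _ ≤ (b + b) + (b + b) := by
          gcongr
          · exact opNormW_cutCore_ladder_mul_le hκ hM (isLadder_ann x) (isLadder_ann x)
              (Or.inr rfl) (Or.inr rfl)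
          · exact opNormW_cutCore_ladder_mul_le hκ hM (isLadder_cre x) (isLadder_ann x)
              (Or.inl rfl) (Or.inr rfl)
          · exact opNormW_cutCore_ladder_mul_le hκ hM (isLadder_ann x) (isLadder_cre x)
              (Or.inr rfl) (Or.inl rfl)
          · exact opNormW_cutCore_ladder_mul_le hκ hM (isLadder_cre x) (isLadder_cre x)
              (Or.inl rfl) (Or.inl rfl)
      _ = 4 * b := by ring
  have h2 : ∀ x' : A, opNormW κ (cutCore M ((g₂ : ℂ) • (cre x * ann x' + ann x * cre x'))) ≤
      2 * b := by
    intro x'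
    refine (hsmul _ _ hg₂).trans ((hadd _ _).trans ?_)
    rw [two_mul]
    gcongr
    · exact opNormW_cutCore_ladder_mul_le hκ hM (isLadder_ann x') (isLadder_cre x)
        (Or.inr rfl) (Or.inl rfl)
    · exact opNormW_cutCore_ladder_mul_le hκ hM (isLadder_cre x') (isLadder_ann x)
        (Or.inl rfl) (Or.inr rfl)
  rw [siteInteraction, add_mul]
  refine (hadd _ _).trans (add_le_add ((hsmul _ _ hg₁).trans h1) ?_)
  rw [cutCore_smul]
  refine (opNormW_smul_le hκ0 _ _).trans ?_
  have h3 : cutCore M (∑ x' : A, if (lattice d).Adj x.1 x'.1 then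
      (g₂ : ℂ) • (cre x * ann x' + ann x * cre x') else 0) = ∑ x' : A, cutCore M
      (if (lattice d).Adj x.1 x'.1 then (g₂ : ℂ) • (cre x * ann x' + ann x * cre x') else 0) :=
    map_sum (cutCoreL M A) _ _
  have h4 : opNormW κ (cutCore M (∑ x' : A, if (lattice d).Adj x.1 x'.1 then
      (g₂ : ℂ) • (cre x * ann x' + ann x * cre x') else 0)) ≤ A.card * (2 * b) := by
    rw [h3]
    refine (opNormW_sum_le hκ0 _ _).trans ?_
    have h5 : ∀ x' : A, opNormW κ (cutCore M (if (lattice d).Adj x.1 x'.1 then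
        (g₂ : ℂ) • (cre x * ann x' + ann x * cre x') else 0)) ≤ 2 * b := by
      intro x'
      split_ifs
      · exact h2 x'
      · rw [show cutCore M (0 : CoreOp A) = 0 from map_zero (cutCoreL M A), opNormW_zero hκ0]
        exact zero_le
    refine (Finset.sum_le_sum fun x' _ => h5 x').trans_eq ?_
    simp
  calc _ ≤ ‖(1 / 2 : ℂ)‖ₑ * (A.card * (2 * b)) := by
        gcongr
    _ = A.card * b := by
        have : ‖(1 / 2 : ℂ)‖ₑ * 2 = 1 := by
          rw [← ofReal_norm, show (2 : ℝ≥0∞) = ENNReal.ofReal 2 by norm_num,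
            ← ENNReal.ofReal_mul (norm_nonneg _)]
          norm_num
        calc _ = (‖(1 / 2 : ℂ)‖ₑ * 2) * (A.card * b) := by ring
          _ = _ := by rw [this, one_mul]

end Ladder

/-! ### The geometry of stars -/

section Star

/-- The site `z` together with its nearest neighbours. -/
def nbhd (z : Site d) : Finset (Site d) :=
  insert z (Finset.univ.image fun p : Fin d × Bool =>
    Function.update z p.1 (z p.1 + if p.2 then 1 else -1))

theorem card_nbhd_le (z : Site d) : (nbhd z).card ≤ 2 * d + 1 := by
  refine (Finset.card_insert_le _ _).trans (Nat.succ_le_succ ?_)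
  refine Finset.card_image_le.trans ?_
  simp [mul_comm]

theorem mem_nbhd_of_adj {z y : Site d} (h : (lattice d).Adj z y) : y ∈ nbhd z := by
  have h1 : ∑ i, |z i - y i| = 1 := h
  obtain ⟨i, -, hi⟩ := Finset.exists_ne_zero_of_sum_ne_zero (by rw [h1]; exact one_ne_zero)
  have h2 := Finset.add_sum_erase Finset.univ (fun i => |z i - y i|) (Finset.mem_univ i)
  have h3 : 0 ≤ ∑ j ∈ Finset.univ.erase i, |z j - y j| := Finset.sum_nonneg fun _ _ => abs_nonneg _
  have h4 : 0 < |z i - y i| := lt_of_le_of_ne (abs_nonneg _) (Ne.symm hi)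
  rw [h1] at h2
  have h5 : ∑ j ∈ Finset.univ.erase i, |z j - y j| = 0 := by omega
  have h6 : |z i - y i| = 1 := by omega
  have h7 : ∀ j, j ≠ i → y j = z j := fun j hj => by
    have := (Finset.sum_eq_zero_iff_of_nonneg fun _ _ => abs_nonneg _).1 h5 j
      (Finset.mem_erase.2 ⟨hj, Finset.mem_univ j⟩)
    have := abs_eq_zero.1 this
    omega
  refine Finset.mem_insert_of_mem (Finset.mem_image.2 ?_)
  rcases abs_eq (zero_le_one) |>.1 h6 with h8 | h8
  · refine ⟨(i, false), Finset.mem_univ _, ?_⟩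
    funext j
    by_cases hj : j = i
    · subst hj
      simp
      omega
    · simp [hj, h7 j hj]
  · refine ⟨(i, true), Finset.mem_univ _, ?_⟩
    funext j
    by_cases hj : j = i
    · subst hj
      simp
      omega
    · simp [hj, h7 j hj]

theorem mem_siteStar {Λ : Finset (Site d)} {x y : Site d} :
    y ∈ siteStar Λ x ↔ y ∈ Λ ∧ (y = x ∨ (lattice d).Adj x y) := by
  simp [siteStar]

theorem siteStar_subset_nbhd (Λ : Finset (Site d)) (x : Site d) : siteStar Λ x ⊆ nbhd x := by
  intro y hy
  rcases (mem_siteStar.1 hy).2 with rfl | h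
  · exact Finset.mem_insert_self _ _
  · exact mem_nbhd_of_adj h

theorem mem_nbhd_of_mem_siteStar {Λ : Finset (Site d)} {x z : Site d} (h : z ∈ siteStar Λ x) :
    x ∈ nbhd z := by
  rcases (mem_siteStar.1 h).2 with rfl | h
  · exact Finset.mem_insert_self _ _
  · exact mem_nbhd_of_adj h.symm

theorem isConn_siteStar {Λ : Finset (Site d)} {x : Site d} (hx : x ∈ siteStar Λ x) :
    IsConn (siteStar Λ x) := by
  refine (SimpleGraph.connected_iff_exists_forall_reachable _).2 ⟨⟨x, hx⟩, fun y => ?_⟩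
  rcases (mem_siteStar.1 y.2).2 with h | h
  · rw [show y = ⟨x, hx⟩ from Subtype.ext h]
  · exact SimpleGraph.Adj.reachable (by simpa using h)

theorem isConn_of_card_eq_one {A : Finset (Site d)} (h : A.card = 1) : IsConn A := by
  obtain ⟨x, rfl⟩ := Finset.card_eq_one.1 h
  refine (SimpleGraph.connected_iff_exists_forall_reachable _).2 ⟨⟨x, by simp⟩, fun y => ?_⟩
  rw [show y = ⟨x, by simp⟩ from Subtype.ext (by simpa using y.2)]

end Star

/-! ### The potential of the interaction -/

section Interaction

variable {κ M : ℝ}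

/-- The potential `ℰ - ℰ₀`: the interaction of each site, placed at its star. -/
def interactionPotential (M g₁ g₂ : ℝ) (Λ : Finset (Site d)) : Potential d := fun A =>
  ∑ x : A, open Classical in
    if siteStar Λ x.1 = A then cutCore M (siteInteraction g₁ g₂ x) else 0

theorem fullPotential_eq (q M g₁ g₂ : ℝ) (Λ : Finset (Site d)) :
    fullPotential q M g₁ g₂ Λ = freePotential q M Λ + interactionPotential M g₁ g₂ Λ := rfl

theorem cut_cutCore {A : Finset (Site d)} (T : CoreOp A) (η η' : Conf A)
    (h : mel (cutCore M T) η η' ≠ 0) : η ∈ cutConf M A ∧ η' ∈ cutConf M A := by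
  rw [mel_cutCore] at h
  by_contra hc
  rw [if_neg hc] at h
  exact h rfl

theorem admissible_freePotential (q M : ℝ) (Λ : Finset (Site d)) :
    Admissible M Λ (freePotential q M Λ) := by
  refine ⟨fun A hA => if_neg fun h => hA (isConn_of_card_eq_one h.1),
    fun A hA => if_neg fun h => hA h.2, fun A η η' hne => ?_⟩
  rw [freePotential] at hne
  split_ifs at hne
  · exact cut_cutCore _ _ _ hne
  · simp at hne

theorem admissible_interactionPotential (M g₁ g₂ : ℝ) (Λ : Finset (Site d)) :
    Admissible M Λ (interactionPotential M g₁ g₂ Λ) := by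
  refine ⟨fun A hA => Finset.sum_eq_zero fun x _ => if_neg fun h => hA ?_,
    fun A hA => Finset.sum_eq_zero fun x _ => if_neg fun h => hA ?_, fun A η η' hne => ?_⟩
  · have hx : x.1 ∈ siteStar Λ x.1 := h.symm ▸ x.2
    rw [← h]
    exact isConn_siteStar hx
  · rw [← h]
    exact fun y hy => (mem_siteStar.1 hy).1
  · rw [interactionPotential, mel_sum] at hne
    obtain ⟨x, -, hne⟩ := Finset.exists_ne_zero_of_sum_ne_zero hne
    split_ifs at hne
    · exact cut_cutCore _ _ _ hne
    · simp at hne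

theorem potW_interactionPotential_le (hκ : 1 ≤ κ) (hM : 1 ≤ M) {g₁ g₂ : ℝ} (hg₁ : |g₁| ≤ 1)
    (hg₂ : |g₂| ≤ 1) (Λ : Finset (Site d)) {l : ℝ} (hl : 1 ≤ l) :
    potW κ l (interactionPotential M g₁ g₂ Λ) ≤
      ENNReal.ofReal ((2 * d + 1) * (l ^ (2 * d + 1) * ((2 * d + 5) * (3 * M * κ ^ 2)))) := by
  classical
  have hκ0 : 0 < κ := zero_lt_one.trans_le hκ
  set D := 2 * d + 1 with hD
  set b := ENNReal.ofReal (3 * M * κ ^ 2) with hb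
  set c : ℝ≥0∞ := ENNReal.ofReal l ^ D * ((4 + D) * b) with hc
  have hl1 : 1 ≤ ENNReal.ofReal l := ENNReal.one_le_ofReal.2 hl
  have hA : ∀ A : Finset (Site d), opNormW κ (interactionPotential M g₁ g₂ Λ A) ≤
      ∑ x ∈ A, if siteStar Λ x = A then (4 + A.card) * b else 0 := by
    intro A
    rw [← Finset.sum_coe_sort A]
    refine (opNormW_sum_le hκ0 _ _).trans (Finset.sum_le_sum fun x _ => ?_)
    split_ifs
    · exact opNormW_cutCore_siteInteraction_le hκ hM hg₁ hg₂ x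
    · rw [opNormW_zero hκ0]
  have hcard : ∀ x, (siteStar Λ x).card ≤ D := fun x =>
    (Finset.card_le_card (siteStar_subset_nbhd Λ x)).trans (card_nbhd_le x)
  have hz : ∀ z, anchoredSum (ENNReal.ofReal l)
      (fun A => opNormW κ (interactionPotential M g₁ g₂ Λ A)) z ≤ D * c := by
    intro z
    calc _ ≤ ∑' A : Finset (Site d), ∑' x : Site d,
          if A = siteStar Λ x then (if x ∈ nbhd z then c else 0) else 0 := by
          refine ENNReal.tsum_le_tsum fun A => ?_
          by_cases hzA : z ∈ A
          swap
          · rw [if_neg hzA]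
            exact zero_le
          rw [if_pos hzA]
          refine le_trans ?_ (ENNReal.sum_le_tsum A)
          refine (mul_le_mul_right (hA A) _).trans ?_
          rw [Finset.mul_sum]
          refine Finset.sum_le_sum fun x hx => ?_
          by_cases hs : siteStar Λ x = A
          · subst hs
            rw [if_pos rfl, if_pos rfl, if_pos (mem_nbhd_of_mem_siteStar hzA), hc]
            have := hcard x
            gcongr
          · rw [if_neg hs, mul_zero]
            exact zero_le
      _ = ∑' x : Site d, if x ∈ nbhd z then c else 0 := by
          rw [ENNReal.tsum_comm]
          exact tsum_congr fun x => tsum_ite_eq _ _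
      _ = ∑ x ∈ nbhd z, c := by
          rw [tsum_eq_sum (s := nbhd z) fun x hx => if_neg hx]
          exact Finset.sum_congr rfl fun x hx => if_pos hx
      _ ≤ D * c := by
          rw [Finset.sum_const, nsmul_eq_mul]
          gcongr
          exact card_nbhd_le z
  refine (iSup_le hz).trans_eq ?_
  have e1 : (4 + D : ℝ≥0∞) = ENNReal.ofReal (2 * d + 5) := by
    rw [show (2 * d + 5 : ℝ) = ((4 + D : ℕ) : ℝ) by rw [hD]; push_cast; ring,
      ENNReal.ofReal_natCast]
    push_cast
    ring
  have e2 : (D : ℝ≥0∞) = ENNReal.ofReal (2 * d + 1) := by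
    rw [show (2 * d + 1 : ℝ) = (D : ℝ) by rw [hD]; push_cast; ring, ENNReal.ofReal_natCast]
  rw [hc, e1, e2, ← ENNReal.ofReal_pow (by linarith), ← ENNReal.ofReal_mul (by positivity),
    ← ENNReal.ofReal_mul (by positivity), ← ENNReal.ofReal_mul (by positivity)]

end Interaction

/-! ### Resonant and nonresonant parts -/

section Resonance

variable {q M δ κ : ℝ} {Λ : Finset (Site d)}

theorem resPart_eq_self {𝒜 : Potential d} (h : ∀ A (η η' : Conf A), mel (𝒜 A) η η' ≠ 0 →
    (η ∈ cutConf M A ∧ η' ∈ cutConf M A) ∧ |energy q η - energy q η'| ≤ δ⁻¹ * M) :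
    resPart q M δ 𝒜 = 𝒜 := by
  funext A
  refine op_ext fun η η' => ?_
  rw [mel_resPart]
  split_ifs with hc
  · rfl
  · by_contra hne
    exact hc (h A η η' (Ne.symm hne))

theorem nresPart_eq_self {𝒜 : Potential d} (h : ∀ A (η η' : Conf A), mel (𝒜 A) η η' ≠ 0 →
    (η ∈ cutConf M A ∧ η' ∈ cutConf M A) ∧ δ⁻¹ * M < |energy q η - energy q η'|) :
    nresPart q M δ 𝒜 = 𝒜 := by
  funext A
  refine op_ext fun η η' => ?_
  rw [mel_nresPart]
  split_ifs with hc
  · rfl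
  · by_contra hne
    exact hc (h A η η' (Ne.symm hne))

theorem of_mel_resPart_ne_zero {𝒜 : Potential d} {A : Finset (Site d)} {η η' : Conf A}
    (h : mel (resPart q M δ 𝒜 A) η η' ≠ 0) :
    ((η ∈ cutConf M A ∧ η' ∈ cutConf M A) ∧ |energy q η - energy q η'| ≤ δ⁻¹ * M) ∧
      mel (𝒜 A) η η' ≠ 0 := by
  rw [mel_resPart] at h
  split_ifs at h with hc
  exacts [⟨hc, h⟩, (h rfl).elim]

theorem of_mel_nresPart_ne_zero {𝒜 : Potential d} {A : Finset (Site d)} {η η' : Conf A}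
    (h : mel (nresPart q M δ 𝒜 A) η η' ≠ 0) :
    ((η ∈ cutConf M A ∧ η' ∈ cutConf M A) ∧ δ⁻¹ * M < |energy q η - energy q η'|) ∧
      mel (𝒜 A) η η' ≠ 0 := by
  rw [mel_nresPart] at h
  split_ifs at h with hc
  exacts [⟨hc, h⟩, (h rfl).elim]

theorem resPart_resPart (𝒜 : Potential d) :
    resPart q M δ (resPart q M δ 𝒜) = resPart q M δ 𝒜 :=
  resPart_eq_self fun _ _ _ h => (of_mel_resPart_ne_zero h).1

theorem nresPart_nresPart (𝒜 : Potential d) :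
    nresPart q M δ (nresPart q M δ 𝒜) = nresPart q M δ 𝒜 :=
  nresPart_eq_self fun _ _ _ h => (of_mel_nresPart_ne_zero h).1

theorem resPart_add (𝒜 ℬ : Potential d) :
    resPart q M δ (𝒜 + ℬ) = resPart q M δ 𝒜 + resPart q M δ ℬ := by
  funext A
  refine op_ext fun η η' => ?_
  rw [Pi.add_apply, mel_add, mel_resPart, mel_resPart, mel_resPart]
  split_ifs <;> simp

theorem Admissible.nresPart_add_resPart {𝒜 : Potential d} (h : Admissible M Λ 𝒜) :
    nresPart q M δ 𝒜 + resPart q M δ 𝒜 = 𝒜 := by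
  funext A
  refine op_ext fun η η' => ?_
  rw [Pi.add_apply, mel_add, mel_resPart, mel_nresPart]
  by_cases hc : η ∈ cutConf M A ∧ η' ∈ cutConf M A
  · by_cases hr : |energy q η - energy q η'| ≤ δ⁻¹ * M
    · simp [hc, hr, not_lt.2 hr]
    · simp [hc, hr, not_le.1 hr]
  · have h0 : mel (𝒜 A) η η' = 0 := by
      by_contra hne
      exact hc (h.cut A η η' hne)
    simp [h0]

theorem Admissible.resPart {𝒜 : Potential d} (h : Admissible M Λ 𝒜) (q δ : ℝ) :
    Admissible M Λ (resPart q M δ 𝒜) :=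
  h.of_mel fun _ _ _ hne => (of_mel_resPart_ne_zero hne).2

theorem Admissible.nresPart {𝒜 : Potential d} (h : Admissible M Λ 𝒜) (q δ : ℝ) :
    Admissible M Λ (nresPart q M δ 𝒜) :=
  h.of_mel fun _ _ _ hne => (of_mel_nresPart_ne_zero hne).2

theorem potW_resPart_le (hκ : 0 < κ) (l q M δ : ℝ) (𝒜 : Potential d) :
    potW κ l (resPart q M δ 𝒜) ≤ potW κ l 𝒜 := by
  refine (potW_le_of_mel_le hκ l (c := 1) fun A η η' => ?_).trans_eq (one_mul _)
  rw [mel_resPart, one_mul]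
  split_ifs <;> simp

theorem potW_nresPart_le (hκ : 0 < κ) (l q M δ : ℝ) (𝒜 : Potential d) :
    potW κ l (nresPart q M δ 𝒜) ≤ potW κ l 𝒜 := by
  refine (potW_le_of_mel_le hκ l (c := 1) fun A η η' => ?_).trans_eq (one_mul _)
  rw [mel_nresPart, one_mul]
  split_ifs <;> simp

end Resonance

/-! ### The homological equation -/

section Homological

variable {q M δ κ : ℝ} {Λ : Finset (Site d)}

/-- The potential with matrix elements `⟨η, 𝒜(A) η'⟩ / (E_A(η) - E_A(η'))`, which solves the
homological equation `ad_𝒦(ℰ₀) = -𝒜` for nonresonant `𝒜`. Matrix elements between configurations of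
the same energy are set to zero, by the convention `0⁻¹ = 0`. -/
def homSol (q M : ℝ) (𝒜 : Potential d) : Potential d := fun A =>
  ∑ p ∈ cutConf M A ×ˢ cutConf M A,
    (((energy q p.1 - energy q p.2)⁻¹ : ℝ) : ℂ) • (proj p.1 * 𝒜 A * proj p.2)

theorem mel_homSol (𝒜 : Potential d) {A : Finset (Site d)} (η η' : Conf A) :
    mel (homSol q M 𝒜 A) η η' = if η ∈ cutConf M A ∧ η' ∈ cutConf M A then
      (((energy q η - energy q η')⁻¹ : ℝ) : ℂ) * mel (𝒜 A) η η' else 0 :=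
  mel_sum_sum_proj M (𝒜 A) (fun η η' => (((energy q η - energy q η')⁻¹ : ℝ) : ℂ)) η η'

theorem Admissible.homSol {𝒜 : Potential d} (h : Admissible M Λ 𝒜) (q : ℝ) :
    Admissible M Λ (homSol q M 𝒜) :=
  h.of_mel fun A η η' hne => by
    rw [mel_homSol] at hne
    split_ifs at hne
    exacts [right_ne_zero_of_mul hne, (hne rfl).elim]

theorem potW_homSol_le (hκ : 0 < κ) (hM : 0 < M) (hδ : 0 < δ) (l : ℝ) {𝒜 : Potential d}
    (h : nresPart q M δ 𝒜 = 𝒜) :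
    potW κ l (homSol q M 𝒜) ≤ ENNReal.ofReal (δ / M) * potW κ l 𝒜 := by
  refine potW_le_of_mel_le hκ l fun A η η' => ?_
  by_cases h0 : mel (𝒜 A) η η' = 0
  · rw [mel_homSol, h0]
    simp
  · rw [← h] at h0
    have h1 := (of_mel_nresPart_ne_zero h0).1
    rw [mel_homSol, if_pos h1.1, enorm_mul]
    gcongr
    rw [← ofReal_norm, Complex.norm_real, Real.norm_eq_abs, abs_inv]
    refine ENNReal.ofReal_le_ofReal ?_
    rw [show δ / M = (δ⁻¹ * M)⁻¹ by rw [mul_inv, inv_inv, div_eq_mul_inv]]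
    exact inv_anti₀ (by positivity) h1.2.le

theorem mel_freePotential (q M : ℝ) {Λ A : Finset (Site d)} (hA : A ⊆ Λ) (η η' : Conf A) :
    mel (freePotential q M Λ A) η η' =
      if A.card = 1 ∧ η ∈ cutConf M A ∧ η = η' then ((energy q η : ℝ) : ℂ) else 0 := by
  classical
  have h1 : (∑ x : A, numPow q x) (Finsupp.single η' 1) η =
      if η = η' then ((energy q η : ℝ) : ℂ) else 0 := by
    simp only [LinearMap.sum_apply, numPow, Finsupp.linearCombination_single, one_smul,
      Finsupp.coe_finsetSum, Finset.sum_apply, Finsupp.single_apply]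
    by_cases h : η = η'
    · subst h
      simp [energy]
    · simp [h, Ne.symm h]
  rw [freePotential]
  by_cases hc : A.card = 1
  · rw [if_pos ⟨hc, hA⟩, mel_cutCore, h1]
    by_cases h : η = η'
    · subst h
      simp [hc]
    · simp [h]
  · rw [if_neg fun h => hc h.1, mel_zero, if_neg fun h => hc h.1]

/-- The free Hamiltonian of the volume `A ⊆ Λ` as the sum of its on-site terms. -/
def freeHam (q M : ℝ) (Λ A : Finset (Site d)) : Op A :=
  ∑ B : A.powerset, extend (Finset.mem_powerset.1 B.2) (freePotential q M Λ B.1)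

theorem mel_freeHam_of_ne (q M : ℝ) {Λ A : Finset (Site d)} (hA : A ⊆ Λ) {η η' : Conf A}
    (hne : η ≠ η') : mel (freeHam q M Λ A) η η' = 0 := by
  rw [freeHam, mel_sum]
  refine Finset.sum_eq_zero fun B _ => ?_
  by_contra h0
  obtain ⟨h1, h2⟩ := mel_extend_ne_zero h0
  rw [mel_freePotential q M ((Finset.mem_powerset.1 B.2).trans hA)] at h2
  split_ifs at h2 with h3
  · refine hne (funext fun x => ?_)
    by_cases hx : x.1 ∈ B.1
    · exact congrFun h3.2.2 ⟨x.1, hx⟩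
    · exact h1 x hx
  · exact h2 rfl

theorem mel_freeHam_self (q M : ℝ) {Λ A : Finset (Site d)} (hA : A ⊆ Λ) {η : Conf A}
    (hη : η ∈ cutConf M A) : mel (freeHam q M Λ A) η η = ((energy q η : ℝ) : ℂ) := by
  classical
  set g : Site d → ℝ := fun y => if h : y ∈ A then ((η ⟨y, h⟩ : ℕ) : ℝ) ^ q else 0 with hg
  have h1 : ∀ B : A.powerset,
      mel (extend (Finset.mem_powerset.1 B.2) (freePotential q M Λ B.1)) η η =
      ((if B.1.card = 1 then ∑ y ∈ B.1, g y else 0 : ℝ) : ℂ) := by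
    intro B
    have hB := Finset.mem_powerset.1 B.2
    have hres : resConf hB η ∈ cutConf M B.1 := mem_cutConf.2 fun x => mem_cutConf.1 hη _
    rw [mel_extend, if_pos fun _ _ => rfl, mel_freePotential q M (hB.trans hA)]
    by_cases hc : B.1.card = 1
    · rw [if_pos ⟨hc, hres, rfl⟩, if_pos hc, energy, ← Finset.sum_coe_sort B.1]
      congr 1
      refine Finset.sum_congr rfl fun x _ => ?_
      simp only [hg]
      rw [dif_pos (hB x.2)]
      rfl
    · rw [if_neg fun h => hc h.1, if_neg hc, Complex.ofReal_zero]
  rw [freeHam, mel_sum]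
  simp only [h1]
  rw [← Complex.ofReal_sum]
  congr 1
  rw [Finset.sum_coe_sort A.powerset fun B => if B.card = 1 then ∑ y ∈ B, g y else 0,
    ← Finset.sum_filter, ← Finset.powersetCard_eq_filter, Finset.powersetCard_one, Finset.sum_map]
  simp only [Function.Embedding.coeFn_mk, Finset.sum_singleton]
  rw [← Finset.sum_coe_sort A, energy]
  refine Finset.sum_congr rfl fun x _ => ?_
  simp only [hg]
  rw [dif_pos x.2]

/-- Only the on-site terms inside of `A₁` fail to commute with `𝒜(A₁)`. -/
theorem ad_freePotential (𝒜 : Potential d) (q M : ℝ) (Λ A : Finset (Site d)) :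
    ad 𝒜 (freePotential q M Λ) A = 𝒜 A * freeHam q M Λ A - freeHam q M Λ A * 𝒜 A := by
  classical
  have hzero : ∀ B : Finset (Site d), B.card ≠ 1 → freePotential q M Λ B = 0 := fun B hB =>
    if_neg fun h => hB h.1
  rw [ad, Finset.sum_eq_single ⟨A, Finset.mem_powerset_self A⟩]
  · rw [freeHam, Finset.mul_sum, Finset.sum_mul, ← Finset.sum_sub_distrib]
    refine Finset.sum_congr rfl fun B _ => ?_
    rw [if_pos (Finset.union_eq_left.2 (Finset.mem_powerset.1 B.2)), Ring.lie_def, extend_self]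
  · intro A₁ _ hne
    refine Finset.sum_eq_zero fun B _ => ?_
    split_ifs with hU
    · by_cases hc : B.1.card = 1
      · refine lie_extend_of_disjoint _ _ ?_ _ _
        obtain ⟨x, hx⟩ := Finset.card_eq_one.1 hc
        rw [hx, Finset.disjoint_singleton_right]
        intro hx1
        refine hne (Subtype.ext ?_)
        rw [hx, Finset.union_eq_left.2 (Finset.singleton_subset_iff.2 hx1)] at hU
        exact hU
      · simp [hzero _ hc, Ring.lie_def]
    · rfl
  · exact fun h => (h (Finset.mem_univ _)).elim

theorem ad_homSol_freePotential (hM : 0 < M) (hδ : 0 < δ) {𝒜 : Potential d}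
    (hadm : Admissible M Λ 𝒜) (h : nresPart q M δ 𝒜 = 𝒜) :
    ad (homSol q M 𝒜) (freePotential q M Λ) = -𝒜 := by
  funext A
  by_cases hA : A ⊆ Λ
  swap
  · rw [((hadm.homSol q).ad (admissible_freePotential q M Λ)).support A hA, Pi.neg_apply,
      hadm.support A hA, neg_zero]
  refine op_ext fun η η' => ?_
  rw [ad_freePotential, mel_sub, mel_mul, mel_mul,
    tsum_eq_single η' fun ζ hζ => by rw [mel_freeHam_of_ne q M hA hζ, mul_zero],
    tsum_eq_single η fun ζ hζ => by rw [mel_freeHam_of_ne q M hA (Ne.symm hζ), zero_mul],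
    Pi.neg_apply, mel_neg]
  by_cases h0 : mel (𝒜 A) η η' = 0
  · rw [mel_homSol, h0]
    simp
  · have h1 := h0
    rw [← h] at h1
    obtain ⟨hc, hE⟩ := (of_mel_nresPart_ne_zero h1).1
    rw [mel_homSol, if_pos hc, mel_freeHam_self q M hA hc.1, mel_freeHam_self q M hA hc.2]
    have hne : energy q η - energy q η' ≠ 0 := by
      intro h2
      rw [h2, abs_zero] at hE
      exact absurd hE (not_lt.2 (by positivity))
    have hne' : ((energy q η : ℝ) : ℂ) - ((energy q η' : ℝ) : ℂ) ≠ 0 := by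
      exact_mod_cast hne
    push_cast
    field_simp
    ring

end Homological

/-! ### One step of the change of variables -/

section Step

variable {M κ l θ : ℝ} {Λ : Finset (Site d)}

theorem summable_of_potW (hκ : 1 ≤ κ) (hl : 1 ≤ l) {𝒜 : ℕ → Potential d}
    (hi : ∀ n, IsInteraction (𝒜 n)) (h : ∑' n, potW κ l (𝒜 n) ≠ ⊤) (A : Finset (Site d)) :
    Summable fun n => 𝒜 n A := by
  rcases A.eq_empty_or_nonempty with rfl | hA
  · have h0 : ¬ IsConn (∅ : Finset (Site d)) := fun hc => by
      obtain ⟨x⟩ := hc.nonempty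
      simpa using x.2
    simp only [fun n => hi n ∅ h0]
    exact summable_zero
  · refine Summable.of_norm ?_
    have h1 : ∑' n, ‖𝒜 n A‖ₑ ≠ ⊤ := ne_top_of_le_ne_top h (ENNReal.tsum_le_tsum fun n =>
      (enorm_le_opNormW hκ _).trans (opNormW_le_potW hl (𝒜 n) hA))
    simpa using ENNReal.summable_toReal h1

theorem tsum_pow_mul_le {x : ℝ≥0∞} (hx : x ≤ 1 / 2) (p : ℝ≥0∞) : ∑' n : ℕ, x ^ n * p ≤ 2 * p := by
  rw [ENNReal.tsum_mul_right, ENNReal.tsum_geometric]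
  gcongr
  rw [ENNReal.inv_le_iff_inv_le]
  calc (2 : ℝ≥0∞)⁻¹ = 1 - 1 / 2 := by
        rw [one_div, ENNReal.one_sub_inv_two]
    _ ≤ 1 - x := by gcongr

/-- If `ad_𝒦(ℰ₀) = -ℱ`, then in `e^{ad_𝒦}(ℰ₀ + ℱ + 𝒢)` the term of first order in `𝒦` acting on
`ℰ₀` cancels `ℱ`, and what remains besides `ℰ₀ + 𝒢` is of first order in `𝒦`, acting on `ℱ` and
`𝒢`. -/
theorem expAd_step (hκ : 1 ≤ κ) (hl : κ ≤ l) (hθ : 0 < θ) {𝒦 ℱ 𝒢 ℰ₀ : Potential d}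
    (hK : Admissible M Λ 𝒦) (hF : Admissible M Λ ℱ) (hG : Admissible M Λ 𝒢)
    (hhom : ad 𝒦 ℰ₀ = -ℱ)
    (hx : ENNReal.ofReal (12 / θ) * potW κ (l * Real.exp θ) 𝒦 ≤ 1 / 2)
    (hFt : potW κ (l * Real.exp θ) ℱ ≠ ⊤) (hGt : potW κ (l * Real.exp θ) 𝒢 ≠ ⊤) :
    ExpAdConverges κ 𝒦 (ℰ₀ + ℱ + 𝒢) ∧
    potW κ l (expAd 𝒦 (ℰ₀ + ℱ + 𝒢) - ℰ₀ - 𝒢) ≤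
      (ENNReal.ofReal (12 / θ) * potW κ (l * Real.exp θ) 𝒦) *
        (4 * potW κ (l * Real.exp θ) ℱ + 2 * potW κ (l * Real.exp θ) 𝒢) := by
  have hκ0 : 0 < κ := zero_lt_one.trans_le hκ
  have hl1 : 1 ≤ l := hκ.trans hl
  set x := ENNReal.ofReal (12 / θ) * potW κ (l * Real.exp θ) 𝒦 with hxdef
  set pF := potW κ (l * Real.exp θ) ℱ with hpF
  set pG := potW κ (l * Real.exp θ) 𝒢 with hpG
  set a : ℕ → Potential d := fun n => expTerm 𝒦 (ℱ + 𝒢) n with ha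
  set b : ℕ → Potential d := fun n => ((n + 1 : ℕ) : ℂ)⁻¹ • expTerm 𝒦 ℱ n with hb
  have haN : ∀ n, potW κ l (a n) ≤ x ^ n * (pF + pG) := fun n =>
    (potW_expTerm_le hκ0 hl1 hθ 𝒦 (ℱ + 𝒢) n).trans (by gcongr; exact potW_add_le hκ0 _ _ _)
  have hbN : ∀ n, potW κ l (b n) ≤ x ^ n * pF := fun n => by
    refine (potW_smul_le hκ0 l _ _).trans ((mul_le_of_le_one_left' ?_).trans
      (potW_expTerm_le hκ0 hl1 hθ 𝒦 ℱ n))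
    rw [← ofReal_norm, norm_inv, Complex.norm_natCast]
    exact ENNReal.ofReal_le_one.2 (inv_le_one_of_one_le₀ (by exact_mod_cast Nat.succ_pos n))
  have haA : ∀ n, Admissible M Λ (a n) := fun n => hK.expTerm (hF.add hG) n
  have hbA : ∀ n, Admissible M Λ (b n) := fun n => (hK.expTerm hF n).smul _
  have hsucc : ∀ n, expTerm 𝒦 (ℰ₀ + ℱ + 𝒢) (n + 1) = a (n + 1) - b n := by
    intro n
    have h1 : ((adL 𝒦) ^ (n + 1)) ℰ₀ = -((adL 𝒦) ^ n) ℱ := by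
      rw [pow_succ, Module.End.mul_apply, show (adL 𝒦) ℰ₀ = -ℱ from hhom, map_neg]
    simp only [ha, hb]
    rw [expTerm_eq, expTerm_eq, expTerm_eq, add_assoc, map_add, h1, smul_add, smul_neg, smul_smul,
      neg_add_eq_sub, Nat.factorial_succ, Nat.cast_mul, mul_inv]
  have hzero : expTerm 𝒦 (ℰ₀ + ℱ + 𝒢) 0 = ℰ₀ + ℱ + 𝒢 := by
    simp [expTerm]
  have hb0 : b 0 = ℱ := by
    simp [hb, expTerm]
  have hat : ∑' n, potW κ l (a n) ≠ ⊤ :=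
    ne_top_of_le_ne_top (ENNReal.mul_ne_top ENNReal.ofNat_ne_top (ENNReal.add_ne_top.2 ⟨hFt, hGt⟩))
      ((ENNReal.tsum_le_tsum haN).trans (tsum_pow_mul_le hx _))
  have hbt : ∑' n, potW κ l (b n) ≠ ⊤ :=
    ne_top_of_le_ne_top (ENNReal.mul_ne_top ENNReal.ofNat_ne_top hFt)
      ((ENNReal.tsum_le_tsum hbN).trans (tsum_pow_mul_le hx _))
  have hsa := summable_of_potW hκ hl1 (fun n => (haA n).interaction) hat
  have hsb := summable_of_potW hκ hl1 (fun n => (hbA n).interaction) hbt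
  have hsum : ∀ A, Summable fun n => expTerm 𝒦 (ℰ₀ + ℱ + 𝒢) n A := by
    intro A
    rw [← summable_nat_add_iff 1]
    simp only [hsucc, Pi.sub_apply]
    exact ((summable_nat_add_iff 1).2 (hsa A)).sub (hsb A)
  have hR : ∀ A, HasSum (fun n => (a (n + 1) - b (n + 1)) A)
      ((expAd 𝒦 (ℰ₀ + ℱ + 𝒢) - ℰ₀ - 𝒢) A) := by
    intro A
    have h1 := ((summable_nat_add_iff 1).2 (hsa A)).hasSum.sub
      ((summable_nat_add_iff 1).2 (hsb A)).hasSum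
    have h2 : (expAd 𝒦 (ℰ₀ + ℱ + 𝒢) - ℰ₀ - 𝒢) A = ∑' n, a (n + 1) A - ∑' n, b (n + 1) A := by
      rw [Pi.sub_apply, Pi.sub_apply, expAd, (hsum A).tsum_eq_zero_add]
      simp only [hsucc, Pi.sub_apply]
      rw [((summable_nat_add_iff 1).2 (hsa A)).tsum_sub (hsb A), (hsb A).tsum_eq_zero_add, hzero,
        hb0, Pi.add_apply, Pi.add_apply]
      abel
    rw [h2]
    exact h1
  refine ⟨?_, ?_⟩
  · have htail : ∀ n, potNorm κ ((∑ j ∈ Finset.range (n + 1), expTerm 𝒦 (ℰ₀ + ℱ + 𝒢) j) -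
        expAd 𝒦 (ℰ₀ + ℱ + 𝒢)) ≤ ∑' j, potW κ l (a (j + n + 1) - b (j + n)) := by
      intro n
      rw [potNorm_eq_potW]
      refine (potW_mono_right hl _).trans ?_
      rw [← potW_neg hκ0, neg_sub]
      refine potW_le_tsum hκ0 l fun A => ?_
      have h1 := (hasSum_nat_add_iff' (n + 1)).2 (hsum A).hasSum
      have h2 : (expAd 𝒦 (ℰ₀ + ℱ + 𝒢) -
          ∑ j ∈ Finset.range (n + 1), expTerm 𝒦 (ℰ₀ + ℱ + 𝒢) j) A =
          ∑' j, expTerm 𝒦 (ℰ₀ + ℱ + 𝒢) j A -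
            ∑ j ∈ Finset.range (n + 1), expTerm 𝒦 (ℰ₀ + ℱ + 𝒢) j A := by
        rw [Pi.sub_apply, Finset.sum_apply, expAd]
      have h3 : ∀ j, a (j + n + 1) - b (j + n) = expTerm 𝒦 (ℰ₀ + ℱ + 𝒢) (j + (n + 1)) := fun j => by
        rw [← add_assoc, hsucc]
      simp only [h2, h3]
      exact h1
    have hfin : ∑' j, potW κ l (a (j + 1) - b j) ≠ ⊤ := by
      refine ne_top_of_le_ne_top (ENNReal.add_ne_top.2 ⟨hat, hbt⟩) ?_
      refine (ENNReal.tsum_le_tsum fun j => potW_sub_le hκ0 l _ _).trans ?_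
      rw [ENNReal.tsum_add]
      exact add_le_add (ENNReal.tsum_comp_le_tsum_of_injective (add_left_injective 1)
        fun n => potW κ l (a n)) le_rfl
    rw [ExpAdConverges, ← Filter.tendsto_add_atTop_iff_nat 1]
    refine tendsto_of_tendsto_of_tendsto_of_le_of_le tendsto_const_nhds
      (ENNReal.tendsto_sum_nat_add _ hfin) (fun _ => zero_le) htail
  · calc _ ≤ ∑' n, potW κ l (a (n + 1) - b (n + 1)) := potW_le_tsum hκ0 l hR
      _ ≤ ∑' n, x ^ n * (x * (2 * pF + pG)) := by
          refine ENNReal.tsum_le_tsum fun n => (potW_sub_le hκ0 l _ _).trans ?_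
          refine (add_le_add (haN _) (hbN _)).trans_eq ?_
          ring
      _ ≤ 2 * (x * (2 * pF + pG)) := tsum_pow_mul_le hx _
      _ = _ := by ring

end Step

/-! ### The iteration -/

section Iteration

/-- The logarithm of the ratio of the volume weights before and after the step number `r`. -/
def weightLoss (r : ℕ) : ℝ := (1 / 2) ^ (r + 1)

/-- The volume weight `κ e^(2^(-r))` of the norm that is controlled after `r` steps. -/
def volWeight (κ : ℝ) (r : ℕ) : ℝ := κ * Real.exp ((1 / 2) ^ r)

/-- The constants `C(r)`. -/
def boundConst (d : ℕ) : ℕ → ℝ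
  | 0 => (2 * d + 1) * (Real.exp 1 ^ (2 * d + 1) * ((2 * d + 5) * 3))
  | r + 1 => boundConst d r + 72 * boundConst d r ^ 2 / weightLoss r

/-- The thresholds `δ₀(r)`. -/
def threshold (d r : ℕ) : ℝ := (weightLoss r / (24 * boundConst d r)) ^ 2

/-- The potentials `ℱ^(r)` and `𝒢^(r)`: in each step, the part of the rotated potential other than
`ℰ₀ + 𝒢^(r)` is split into its nonresonant part, which becomes `ℱ^(r+1)`, and its resonant part,
which is added to `𝒢^(r)`. -/
def diagPair (q M δ g₁ g₂ : ℝ) (Λ : Finset (Site d)) : ℕ → Potential d × Potential d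
  | 0 => (nresPart q M δ (interactionPotential M g₁ g₂ Λ),
      resPart q M δ (interactionPotential M g₁ g₂ Λ))
  | r + 1 =>
    let F := (diagPair q M δ g₁ g₂ Λ r).1
    let G := (diagPair q M δ g₁ g₂ Λ r).2
    let R := expAd (homSol q M F) (freePotential q M Λ + F + G) - freePotential q M Λ - G
    (nresPart q M δ R, G + resPart q M δ R)

theorem weightLoss_pos (r : ℕ) : 0 < weightLoss r := by
  unfold weightLoss
  positivity

theorem volWeight_succ (κ : ℝ) (r : ℕ) :
    volWeight κ (r + 1) * Real.exp (weightLoss r) = volWeight κ r := by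
  rw [volWeight, volWeight, weightLoss, mul_assoc, ← Real.exp_add]
  congr 2
  ring

theorem le_volWeight {κ : ℝ} (hκ : 0 ≤ κ) (r : ℕ) : κ ≤ volWeight κ r :=
  le_mul_of_one_le_right hκ (Real.one_le_exp (by positivity))

theorem boundConst_pos (d r : ℕ) : 0 < boundConst d r := by
  induction r with
  | zero =>
    unfold boundConst
    positivity
  | succ r ih =>
    have := weightLoss_pos r
    unfold boundConst
    positivity

theorem boundConst_le_succ (d r : ℕ) : boundConst d r ≤ boundConst d (r + 1) := by
  have h1 := boundConst_pos d r
  have h2 := weightLoss_pos r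
  rw [show boundConst d (r + 1) = boundConst d r + 72 * boundConst d r ^ 2 / weightLoss r from rfl]
  have : 0 < 72 * boundConst d r ^ 2 / weightLoss r := by positivity
  linarith

theorem threshold_pos (d r : ℕ) : 0 < threshold d r := by
  have h1 := boundConst_pos d r
  have h2 := weightLoss_pos r
  unfold threshold
  positivity

theorem antitone_threshold (d : ℕ) : Antitone (threshold d) := by
  refine antitone_nat_of_succ_le fun r => ?_
  have h1 := boundConst_pos d r
  have h2 := weightLoss_pos r
  have h3 := boundConst_le_succ d r
  have h4 := weightLoss_pos (r + 1)
  have h5 : weightLoss (r + 1) ≤ weightLoss r := by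
    rw [weightLoss, weightLoss, pow_succ _ (r + 1)]
    have : (0 : ℝ) < (1 / 2) ^ (r + 1) := by positivity
    linarith
  have h6 := boundConst_pos d (r + 1)
  have h7 : 0 ≤ weightLoss (r + 1) / (24 * boundConst d (r + 1)) := by positivity
  unfold threshold
  gcongr

/-- The smallness of `δ` that makes the exponential series in step `r` converge geometrically. -/
theorem smallness {δ : ℝ} (hδ : 0 < δ) (hδ1 : δ < 1) {d r : ℕ} (h : δ < threshold d r) :
    12 / weightLoss r * (boundConst d r * δ ^ ((2 * (r : ℝ) - 1) / 3 + 1)) ≤ 1 / 2 := by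
  have h1 := boundConst_pos d r
  have h2 := weightLoss_pos r
  have h3 : δ ^ ((2 * (r : ℝ) - 1) / 3 + 1) ≤ weightLoss r / (24 * boundConst d r) := by
    calc δ ^ ((2 * (r : ℝ) - 1) / 3 + 1) ≤ δ ^ (1 / 2 : ℝ) := by
          refine Real.rpow_le_rpow_of_exponent_ge hδ hδ1.le ?_
          have : (0 : ℝ) ≤ r := Nat.cast_nonneg r
          linarith
      _ ≤ threshold d r ^ (1 / 2 : ℝ) := Real.rpow_le_rpow hδ.le h.le (by norm_num)
      _ = weightLoss r / (24 * boundConst d r) := by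
          rw [threshold, ← Real.sqrt_eq_rpow, Real.sqrt_sq (by positivity)]
  calc _ ≤ 12 / weightLoss r * (boundConst d r * (weightLoss r / (24 * boundConst d r))) := by
        gcongr
    _ = 1 / 2 := by
        field_simp
        norm_num

/-- The properties of `ℱ^(r)` and `𝒢^(r)` that are propagated by the iteration. -/
structure StepInvariant (q M δ κ : ℝ) (Λ : Finset (Site d)) (r : ℕ) (F G : Potential d) : Prop where
  admF : Admissible M Λ F
  admG : Admissible M Λ G
  nresF : nresPart q M δ F = F
  resG : resPart q M δ G = G
  boundF : potW κ (volWeight κ r) F ≤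
    ENNReal.ofReal (boundConst d r * M * δ ^ ((2 * (r : ℝ) - 1) / 3))
  boundG : potW κ (volWeight κ r) G ≤
    ENNReal.ofReal (boundConst d r * δ ^ (-(1 / 3) : ℝ) * M)

variable {q M δ κ g₁ g₂ : ℝ} {Λ : Finset (Site d)}

theorem StepInvariant.boundK {r : ℕ} {F G : Potential d} (h : StepInvariant q M δ κ Λ r F G)
    (hκ : 0 < κ) (hM : 1 ≤ M) (hδ : 0 < δ) : potW κ (volWeight κ r) (homSol q M F) ≤
      ENNReal.ofReal (boundConst d r * δ ^ ((2 * (r : ℝ) - 1) / 3 + 1)) := by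
  have hM0 : 0 < M := zero_lt_one.trans_le hM
  refine (potW_homSol_le hκ hM0 hδ _ h.nresF).trans ?_
  refine (mul_le_mul_right h.boundF _).trans_eq ?_
  rw [← ENNReal.ofReal_mul (by positivity), Real.rpow_add_one hδ.ne']
  congr 1
  field_simp

theorem stepInvariant_zero (hM : 1 ≤ M) (hδ : 0 < δ) (hδ1 : δ < 1) (hg₁ : |g₁| ≤ 1) (hg₂ : |g₂| ≤ 1)
    (hκ : κ = δ ^ (-(1 / (4 * (2 * (d : ℝ) + 3))))) :
    StepInvariant q M δ κ Λ 0 (diagPair q M δ g₁ g₂ Λ 0).1 (diagPair q M δ g₁ g₂ Λ 0).2 := by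
  have hκ1 : 1 ≤ κ := by
    rw [hκ]
    refine Real.one_le_rpow_of_pos_of_le_one_of_nonpos hδ hδ1.le ?_
    rw [neg_nonpos]
    positivity
  have hκ0 : 0 < κ := zero_lt_one.trans_le hκ1
  have hadm := admissible_interactionPotential M g₁ g₂ Λ
  -- A star with at most `2d+1` sites and two ladder operators cost `κ^(2d+3) = δ^(-1/4)`.
  have hpow : κ ^ (2 * d + 1) * κ ^ 2 ≤ δ ^ (-(1 / 3) : ℝ) := by
    rw [← pow_add, hκ, ← Real.rpow_natCast, ← Real.rpow_mul hδ.le]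
    refine Real.rpow_le_rpow_of_exponent_ge hδ hδ1.le ?_
    have h3 : (2 * (d : ℝ) + 3) ≠ 0 := by positivity
    have : -(1 / (4 * (2 * (d : ℝ) + 3))) * ((2 * d + 1 + 2 : ℕ) : ℝ) = -(1 / 4) := by
      push_cast
      field_simp
      ring
    rw [this]
    norm_num
  have hV : potW κ (volWeight κ 0) (interactionPotential M g₁ g₂ Λ) ≤
      ENNReal.ofReal (boundConst d 0 * M * δ ^ (-(1 / 3) : ℝ)) := by
    refine (potW_interactionPotential_le hκ1 hM hg₁ hg₂ Λ
      (hκ1.trans (le_volWeight hκ0.le 0))).trans (ENNReal.ofReal_le_ofReal ?_)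
    calc _ = boundConst d 0 * M * (κ ^ (2 * d + 1) * κ ^ 2) := by
          rw [volWeight, boundConst, pow_zero, mul_pow]
          ring
      _ ≤ _ := by
          have := boundConst_pos d 0
          gcongr
  refine ⟨hadm.nresPart q δ, hadm.resPart q δ, nresPart_nresPart _, resPart_resPart _, ?_, ?_⟩
  · refine (potW_nresPart_le hκ0 _ q M δ _).trans (hV.trans_eq ?_)
    norm_num
  · refine (potW_resPart_le hκ0 _ q M δ _).trans (hV.trans_eq ?_)
    congr 1
    ring

theorem StepInvariant.succ {r : ℕ} (hκ : 1 ≤ κ) (hM : 1 ≤ M) (hδ : 0 < δ) (hδ1 : δ < 1)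
    (hr : δ < threshold d r)
    (h : StepInvariant q M δ κ Λ r (diagPair q M δ g₁ g₂ Λ r).1 (diagPair q M δ g₁ g₂ Λ r).2) :
    StepInvariant q M δ κ Λ (r + 1) (diagPair q M δ g₁ g₂ Λ (r + 1)).1
        (diagPair q M δ g₁ g₂ Λ (r + 1)).2 ∧
      ExpAdConverges κ (homSol q M (diagPair q M δ g₁ g₂ Λ r).1) (freePotential q M Λ +
        (diagPair q M δ g₁ g₂ Λ r).1 + (diagPair q M δ g₁ g₂ Λ r).2) ∧
      expAd (homSol q M (diagPair q M δ g₁ g₂ Λ r).1) (freePotential q M Λ +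
        (diagPair q M δ g₁ g₂ Λ r).1 + (diagPair q M δ g₁ g₂ Λ r).2) = freePotential q M Λ +
        (diagPair q M δ g₁ g₂ Λ (r + 1)).1 + (diagPair q M δ g₁ g₂ Λ (r + 1)).2 := by
  have hκ0 : 0 < κ := zero_lt_one.trans_le hκ
  have hM0 : 0 < M := zero_lt_one.trans_le hM
  have hC := boundConst_pos d r
  have hθ := weightLoss_pos r
  rw [show (diagPair q M δ g₁ g₂ Λ (r + 1)) =
    (nresPart q M δ (expAd (homSol q M (diagPair q M δ g₁ g₂ Λ r).1) (freePotential q M Λ +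
      (diagPair q M δ g₁ g₂ Λ r).1 + (diagPair q M δ g₁ g₂ Λ r).2) - freePotential q M Λ -
      (diagPair q M δ g₁ g₂ Λ r).2),
    (diagPair q M δ g₁ g₂ Λ r).2 + resPart q M δ (expAd (homSol q M (diagPair q M δ g₁ g₂ Λ r).1)
      (freePotential q M Λ + (diagPair q M δ g₁ g₂ Λ r).1 + (diagPair q M δ g₁ g₂ Λ r).2) -
      freePotential q M Λ - (diagPair q M δ g₁ g₂ Λ r).2)) from rfl]
  set F := (diagPair q M δ g₁ g₂ Λ r).1
  set G := (diagPair q M δ g₁ g₂ Λ r).2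
  set E := freePotential q M Λ with hE
  set R := expAd (homSol q M F) (E + F + G) - E - G with hR
  have hF := h.boundF
  have hG := h.boundG
  have hK := h.boundK hκ0 hM hδ
  rw [← volWeight_succ κ r] at hF hG hK
  have hx : ENNReal.ofReal (12 / weightLoss r) *
      potW κ (volWeight κ (r + 1) * Real.exp (weightLoss r)) (homSol q M F) ≤ ENNReal.ofReal
        (12 / weightLoss r * (boundConst d r * δ ^ ((2 * (r : ℝ) - 1) / 3 + 1))) := by
    rw [ENNReal.ofReal_mul (by positivity)]
    gcongr
  have hhalf : ENNReal.ofReal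
      (12 / weightLoss r * (boundConst d r * δ ^ ((2 * (r : ℝ) - 1) / 3 + 1))) ≤ 1 / 2 := by
    refine (ENNReal.ofReal_le_ofReal (smallness hδ hδ1 hr)).trans_eq ?_
    rw [ENNReal.ofReal_div_of_pos two_pos]
    simp
  obtain ⟨hconv, hRb⟩ := expAd_step hκ (le_volWeight hκ0.le (r + 1)) hθ (h.admF.homSol q) h.admF
    h.admG (ad_homSol_freePotential hM0 hδ h.admF h.nresF) (hx.trans hhalf)
    (ne_top_of_le_ne_top ENNReal.ofReal_ne_top hF) (ne_top_of_le_ne_top ENNReal.ofReal_ne_top hG)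
  have hadmE := admissible_freePotential q M Λ
  have hadmR : Admissible M Λ R :=
    (((h.admF.homSol q).expAd ((hadmE.add h.admF).add h.admG)).sub hadmE).sub h.admG
  have hF' : potW κ (volWeight κ (r + 1) * Real.exp (weightLoss r)) F ≤
      ENNReal.ofReal (boundConst d r * δ ^ (-(1 / 3) : ℝ) * M) := by
    refine hF.trans (ENNReal.ofReal_le_ofReal ?_)
    rw [mul_right_comm]
    gcongr ?_ * M
    refine mul_le_mul_of_nonneg_left (Real.rpow_le_rpow_of_exponent_ge hδ hδ1.le ?_) hC.le
    have : (0 : ℝ) ≤ r := Nat.cast_nonneg r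
    linarith
  -- A factor `δ^(e(r)+1)` from `𝒦` and `δ^(-1/3)` from `𝒢` combine to `δ^(e(r+1))`.
  have hRb' : potW κ (volWeight κ (r + 1)) R ≤ ENNReal.ofReal
      (72 * boundConst d r ^ 2 / weightLoss r * M * δ ^ ((2 * ((r + 1 : ℕ) : ℝ) - 1) / 3)) := by
    refine hRb.trans ?_
    calc _ ≤ ENNReal.ofReal
          (12 / weightLoss r * (boundConst d r * δ ^ ((2 * (r : ℝ) - 1) / 3 + 1))) *
          (4 * ENNReal.ofReal (boundConst d r * δ ^ (-(1 / 3) : ℝ) * M) +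
            2 * ENNReal.ofReal (boundConst d r * δ ^ (-(1 / 3) : ℝ) * M)) := by gcongr
      _ = ENNReal.ofReal
          (12 / weightLoss r * (boundConst d r * δ ^ ((2 * (r : ℝ) - 1) / 3 + 1))) *
          (ENNReal.ofReal 6 * ENNReal.ofReal (boundConst d r * δ ^ (-(1 / 3) : ℝ) * M)) := by
          rw [← add_mul]
          norm_num
      _ = _ := by
          rw [← ENNReal.ofReal_mul (by norm_num), ← ENNReal.ofReal_mul (by positivity)]
          congr 1
          have : δ ^ ((2 * ((r + 1 : ℕ) : ℝ) - 1) / 3) =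
              δ ^ ((2 * (r : ℝ) - 1) / 3 + 1) * δ ^ (-(1 / 3) : ℝ) := by
            rw [← Real.rpow_add hδ]
            congr 1
            push_cast
            ring
          rw [this]
          ring
  have hsucc : boundConst d (r + 1) = boundConst d r + 72 * boundConst d r ^ 2 / weightLoss r := rfl
  refine ⟨⟨hadmR.nresPart q δ, h.admG.add (hadmR.resPart q δ), nresPart_nresPart _, ?_, ?_, ?_⟩,
    hconv, ?_⟩
  · change resPart q M δ (G + resPart q M δ R) = G + resPart q M δ R
    rw [resPart_add, h.resG, resPart_resPart]
  · refine (potW_nresPart_le hκ0 _ q M δ _).trans (hRb'.trans (ENNReal.ofReal_le_ofReal ?_))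
    rw [hsucc]
    gcongr
    linarith
  · refine (potW_add_le hκ0 _ _ _).trans ?_
    have h1 : potW κ (volWeight κ (r + 1)) G ≤ ENNReal.ofReal
        (boundConst d r * δ ^ (-(1 / 3) : ℝ) * M) := by
      refine le_trans (potW_mono_right ?_ _) hG
      have := hκ0.le.trans (le_volWeight hκ0.le (r + 1))
      exact le_mul_of_one_le_right this (Real.one_le_exp hθ.le)
    refine (add_le_add h1 ((potW_resPart_le hκ0 _ q M δ _).trans hRb')).trans ?_
    rw [← ENNReal.ofReal_add (by positivity) (by positivity)]
    refine ENNReal.ofReal_le_ofReal ?_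
    have h2 : δ ^ ((2 * ((r + 1 : ℕ) : ℝ) - 1) / 3) ≤ δ ^ (-(1 / 3) : ℝ) := by
      refine Real.rpow_le_rpow_of_exponent_ge hδ hδ1.le ?_
      have : (0 : ℝ) ≤ r := Nat.cast_nonneg r
      push_cast
      linarith
    calc _ ≤ boundConst d r * δ ^ (-(1 / 3) : ℝ) * M +
          72 * boundConst d r ^ 2 / weightLoss r * M * δ ^ (-(1 / 3) : ℝ) := by gcongr
      _ = _ := by rw [hsucc]; ring
  · have h1 : nresPart q M δ R + resPart q M δ R = R := hadmR.nresPart_add_resPart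
    have h2 : expAd (homSol q M F) (E + F + G) = E + G + R := by
      rw [hR]
      abel
    change expAd (homSol q M F) (E + F + G) = E + nresPart q M δ R + (G + resPart q M δ R)
    rw [h2]
    nth_rw 1 [← h1]
    abel

end Iteration

end

end MBL

theorem proposition4p1 (d : ℕ) (hd : 1 ≤ d) (q : ℝ) (hq : 2 < q) :
    ∃ C δ₀ : ℕ → ℝ, (∀ r, 0 < δ₀ r) ∧ Antitone δ₀ ∧
      ∀ (M : ℝ), 1 ≤ M → ∀ (g₁ g₂ : ℝ), |g₁| ≤ 1 → |g₂| ≤ 1 →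
      ∀ (Λ : Finset (MBL.Site d)) (δ : ℝ), 0 < δ → δ < 1 →
      ∃ K F G : ℕ → MBL.Potential d, ∀ r : ℕ, δ < δ₀ r →
        -- all of them are interaction potentials with the cutoff `M`
        (MBL.IsInteraction (K (r + 1)) ∧ MBL.IsInteraction (F r) ∧ MBL.IsInteraction (G r)) ∧
        (MBL.cutPotential M (K (r + 1)) = K (r + 1) ∧ MBL.cutPotential M (F r) = F r ∧
          MBL.cutPotential M (G r) = G r) ∧
        -- the change of variables, with convergence of all exponential series involved
        (∀ j < r, MBL.ExpAdConverges (δ ^ (-(1 / (4 * (2 * (d : ℝ) + 3))))) (K (j + 1))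
          (MBL.iterExpAd K (MBL.fullPotential q M g₁ g₂ Λ) j)) ∧
        MBL.iterExpAd K (MBL.fullPotential q M g₁ g₂ Λ) r =
          MBL.freePotential q M Λ + F r + G r ∧
        -- `F r` is small and nonresonant
        MBL.potNorm (δ ^ (-(1 / (4 * (2 * (d : ℝ) + 3))))) (F r) ≤
          ENNReal.ofReal (C r * M * δ ^ ((2 * (r : ℝ) - 1) / 3)) ∧
        MBL.nresPart q M δ (F r) = F r ∧
        -- `G r` is not too big and resonant
        MBL.potNorm (δ ^ (-(1 / (4 * (2 * (d : ℝ) + 3))))) (G r) ≤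
          ENNReal.ofReal (C r * δ ^ (-(1 / 3) : ℝ) * M) ∧
        MBL.resPart q M δ (G r) = G r ∧
        -- `K (r + 1)` is small
        MBL.potNorm (δ ^ (-(1 / (4 * (2 * (d : ℝ) + 3))))) (K (r + 1)) ≤
          ENNReal.ofReal (C r * δ ^ ((2 * (r : ℝ) - 1) / 3 + 1)) := by
  refine ⟨MBL.boundConst d, MBL.threshold d, MBL.threshold_pos d, MBL.antitone_threshold d, ?_⟩
  intro M hM g₁ g₂ hg₁ hg₂ Λ δ hδ hδ1
  set κ : ℝ := δ ^ (-(1 / (4 * (2 * (d : ℝ) + 3)))) with hκ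
  have hκ1 : 1 ≤ κ := by
    rw [hκ]
    refine Real.one_le_rpow_of_pos_of_le_one_of_nonpos hδ hδ1.le ?_
    rw [neg_nonpos]
    positivity
  have hκ0 : 0 < κ := zero_lt_one.trans_le hκ1
  set F : ℕ → MBL.Potential d := fun r => (MBL.diagPair q M δ g₁ g₂ Λ r).1 with hF
  set G : ℕ → MBL.Potential d := fun r => (MBL.diagPair q M δ g₁ g₂ Λ r).2 with hG
  set K : ℕ → MBL.Potential d := fun r => MBL.homSol q M (F (r - 1)) with hK
  refine ⟨K, F, G, fun r hr => ?_⟩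
  have hlt : ∀ j ≤ r, δ < MBL.threshold d j := fun j hj =>
    hr.trans_le (MBL.antitone_threshold d hj)
  have hinv : ∀ j ≤ r, MBL.StepInvariant q M δ κ Λ j (F j) (G j) := by
    intro j
    induction j with
    | zero => exact fun _ => MBL.stepInvariant_zero hM hδ hδ1 hg₁ hg₂ hκ
    | succ j ih => exact fun hj =>
        (MBL.StepInvariant.succ hκ1 hM hδ hδ1 (hlt j (by omega)) (ih (by omega))).1
  have hstep := fun j (hj : j ≤ r) =>
    (MBL.StepInvariant.succ hκ1 hM hδ hδ1 (hlt j hj) (hinv j hj)).2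
  have hiter : ∀ j ≤ r, MBL.iterExpAd K (MBL.fullPotential q M g₁ g₂ Λ) j =
      MBL.freePotential q M Λ + F j + G j := by
    intro j
    induction j with
    | zero =>
      intro _
      rw [MBL.iterExpAd, MBL.fullPotential_eq, add_assoc]
      congr 1
      exact (MBL.admissible_interactionPotential M g₁ g₂ Λ).nresPart_add_resPart.symm
    | succ j ih =>
      intro hj
      rw [MBL.iterExpAd, ih (by omega)]
      exact (hstep j (by omega)).2
  have h := hinv r le_rfl
  have hnorm : ∀ 𝒜 : MBL.Potential d,
      MBL.potNorm κ 𝒜 ≤ MBL.potW κ (MBL.volWeight κ r) 𝒜 := fun 𝒜 => by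
    rw [MBL.potNorm_eq_potW]
    exact MBL.potW_mono_right (MBL.le_volWeight hκ0.le r) 𝒜
  have hadmK : MBL.Admissible M Λ (K (r + 1)) := h.admF.homSol q
  refine ⟨⟨hadmK.interaction, h.admF.interaction, h.admG.interaction⟩,
    ⟨hadmK.cutPotential_eq, h.admF.cutPotential_eq, h.admG.cutPotential_eq⟩, fun j hj => ?_,
    hiter r le_rfl, (hnorm _).trans h.boundF, h.nresF, (hnorm _).trans h.boundG, h.resG,
    (hnorm _).trans (h.boundK hκ0 hM hδ)⟩
  rw [hiter j hj.le]
  exact (hstep j hj.le).1
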